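/- Let $\mathcal X=\{1,\dots,d\}$, let $\mathcal Y$ be a measurable space with a reference measure $dy$, let $\Theta\subset\mathbb R^k$ with coordinates $\theta=(\theta^{j,x})_{x\in\mathcal X,\,1\le j\le k_x}$, $\sum_{x}k_x=k$, and let $\{W_\theta\}_{\theta\in\Theta}$ be a family of channels from $\mathcal X$ to $\mathcal Y$; $W_\theta$ is given by probability densities $W_{\theta,x}(y)$ with respect to $dy$, $x\in\mathcal X$. For probability densities $p,q$ and $s>0$ put $D_{1+s}(p\|q)=\frac1s\log\int p(y)^{1+s}q(y)^{-s}\,dy\in(-\infty,+\infty]$. Consider the following conditions. Condition A. There are a channel $W_0$ with densities $W_{0,x}$ and measurable functions $g_{j,x}:\mathcal Y\to\mathbb R$ with $W_{\theta,x}(y)=W_{0,x}(y)\exp\big(\sum_{j=1}^{k_x}\theta^{j,x}g_{j,x}(y)-\phi_x(\theta)\big)$ for $\theta\in\Theta$, where $\phi_x(\theta)=\log\int W_{0,x}(y)\exp\big(\sum_{j}\theta^{j,x}g_{j,x}(y)\big)dy$, and for all $x$ the functions $\phi_x$ are finite and $C^2$ on $\Theta$ (if $\Theta$ is neither open nor convex: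 on a set $U\supseteq\Theta$ that is open or convex). Condition B. $\Theta$ is compact. For every $x$, the derivative $l_{\theta,x}(y)=\nabla_\theta\log W_{\theta,x}(y)$ exists for each $\theta\in\Theta$ and $W_{\theta,x}$-almost every $y$, and $J_{\theta,x}=\int W_{\theta,x}(y)\,l_{\theta,x}(y)l_{\theta,x}(y)^{T}dy$ is finite and continuous in $\theta\in\Theta$. For every $x$ and every $s>0$, the map $(\theta,\theta')\mapsto D_{1+s}(W_{\theta,x}\|W_{\theta',x})$ is continuous on $\Theta\times\Theta$, and, as $\epsilon\to0$ with $\theta+\epsilon\in\Theta$, $2D_{1+s}(W_{\theta,x}\|W_{\theta+\epsilon,x})=(1+s)\,\epsilon^{T}J_{\theta,x}\epsilon+o(\|\epsilon\|^2)$ uniformly in $\theta\in\Theta$. Condition C. The same as Condition B, except that $\Theta$ is only required to be the union of an increasing sequence of compact subsets $\Theta_1\subset\Theta_2\subset\cdots$ of $\Theta$, and that the expansion is required to hold uniformly in $\theta$ on every compact subset of $\Theta$. For a probability distribution $P$ on $\mathcal X$ let $W_\theta\cdot P=\sum_xP(x)W_{\theta,x}$, $$I(P,W_\theta)=\sum_xP(x)\int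 W_{\theta,x}(y)\log\frac{W_{\theta,x}(y)}{W_\theta\cdot P(y)}\,dy,\qquad V(P,W_\theta)=\sum_xP(x)\int W_{\theta,x}(y)\Big(\log\frac{W_{\theta,x}(y)}{W_\theta\cdot P(y)}-I(P,W_\theta)\Big)^2dy.$$ A code $\Phi_n=(M_n,E_n,D_n)$ of block length $n$ consists of a size $M_n$, an encoder $E_n:\{1,\dots,M_n\}\to\mathcal X^n$ and a measurable decoder $D_n:\mathcal Y^n\to\{1,\dots,M_n\}$; its average error probability for the memoryless channel $W^n_{\theta,x^n}=\prod_{t=1}^nW_{\theta,x_t}$ is $e_\theta(\Phi_n)=\frac1{M_n}\sum_{i}\sum_{j\ne i}W^n_{\theta,E_n(i)}(D_n^{-1}(j))$. Theorem. Let $R_1^*,R_2^*$ be real numbers and $P$ a distribution on $\mathcal X$. Assume that $\{W_\theta\}_{\theta\in\Theta}$ satisfies Condition A, B or C, and that $0<I(P,W_\theta)<\infty$ and $0<V(P,W_\theta)<\infty$ for all $\theta\in\Theta$. Then there is a sequence of codes $\Phi_n$, not depending on $\theta$, of size $M_n=\lceil e^{nR_1^*+\sqrt n\,R_2^*-n^{1/4}}\rceil$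 such that for every $\theta\in\Theta$: (1) if $I(P,W_\theta)>R_1^*$, then $\lim_{n\to\infty}e_\theta(\Phi_n)=0$; (2) if $I(P,W_\theta)=R_1^*$, then $$\limsup_{n\to\infty}e_\theta(\Phi_n)\le\int_{-\infty}^{R_2^*/\sqrt{V(P,W_\theta)}}\frac1{\sqrt{2\pi}}\exp\Big(-\frac{x^2}{2}\Big)dx .$$ -/

import Mathlib

open MeasureTheory Filter Topology
open scoped ENNReal NNReal

noncomputable section

namespace UniversalCoding

variable {d : ℕ} {𝒴 : Type*} [MeasurableSpace 𝒴] {μ : Measure 𝒴}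

/-- A channel from the input alphabet `Fin d` to a measurable space `𝒴`: for every input `x` a
probability density `density x` with respect to the reference measure `μ` (written `dy`). -/
structure Channel (d : ℕ) {𝒴 : Type*} [MeasurableSpace 𝒴] (μ : Measure 𝒴) where
  /-- the density `W_x(y)` -/
  density : Fin d → 𝒴 → ℝ≥0
  measurable_density : ∀ x, Measurable (density x)
  lintegral_density : ∀ x, ∫⁻ y, (density x y : ℝ≥0∞) ∂μ = 1

namespace Channel

/-- The output distribution `W_x` on `𝒴` for the input `x`. -/
def law (W : Channel d μ) (x : Fin d) : Measure 𝒴 :=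
  μ.withDensity fun y => (W.density x y : ℝ≥0∞)

instance (W : Channel d μ) (x : Fin d) : IsProbabilityMeasure (W.law x) :=
  ⟨by rw [law, withDensity_apply _ MeasurableSet.univ, Measure.restrict_univ,
    W.lintegral_density]⟩

/-- The memoryless extension: the output distribution `W_{x^n}^n` on `𝒴^n` for the input `x^n`. -/
def nLaw (W : Channel d μ) {n : ℕ} (x : Fin n → Fin d) : Measure (Fin n → 𝒴) :=
  Measure.pi fun t => W.law (x t)

/-- The density of the mixture `W · P` of the output distributions. -/
def mixDensity (W : Channel d μ) (P : PMF (Fin d)) (y : 𝒴) : ℝ≥0 :=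
  ∑ x, (P x).toNNReal * W.density x y

/-- The mixture `W · P` of the output distributions. -/
def mixLaw (W : Channel d μ) (P : PMF (Fin d)) : Measure 𝒴 :=
  μ.withDensity fun y => (W.mixDensity P y : ℝ≥0∞)

end Channel

/-- The mutual information `I(P, W) = ∑ x, P(x) D(W_x ‖ W · P)`, in nats. -/
def mutualInfo (P : PMF (Fin d)) (W : Channel d μ) : ℝ≥0∞ :=
  ∑ x, P x * InformationTheory.klDiv (W.law x) (W.mixLaw P)

/-- The variance `V(P, W) = ∑ x, P(x) E_{W_x} [(log (W_x(Y) / (W · P)(Y)) - I(P, W))²]`. -/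
def infoVariance (P : PMF (Fin d)) (W : Channel d μ) : ℝ≥0∞ :=
  ∑ x, P x * ∫⁻ y, ENNReal.ofReal
    ((Real.log ((W.density x y : ℝ) / (W.mixDensity P y : ℝ)) - (mutualInfo P W).toReal) ^ 2)
      ∂(W.law x)

/-- The Rényi divergence `D_{1+s}(p ‖ q) = (1/s) log ∫ p (p/q)^s dy` of order `1 + s`, `s > 0`, of
two probability densities; it is `⊤` if the integral is infinite. -/
def renyiDiv (μ : Measure 𝒴) (s : ℝ) (p q : 𝒴 → ℝ≥0) : EReal :=
  ((s⁻¹ : ℝ) : EReal) *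
    ENNReal.log (∫⁻ y, (p y : ℝ≥0∞) ^ (1 + s) * (q y : ℝ≥0∞) ^ (-s) ∂μ)

/-- The parameter space `ℝ^k`, `k = ∑ x, k_x`, with coordinates `θ^{j,x}`. -/
abbrev Param {d : ℕ} (k : Fin d → ℕ) : Type := EuclideanSpace ℝ (Σ x : Fin d, Fin (k x))

variable {k : Fin d → ℕ}

/-- The moment generating function `∫ W_{0,x}(y) exp (∑ j, θ^{j,x} g_{j,x}(y)) dy`. -/
def mgfAt (W₀ : Channel d μ) (g : (x : Fin d) → Fin (k x) → 𝒴 → ℝ) (x : Fin d)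
    (θ : Param k) : ℝ≥0∞ :=
  ∫⁻ y, (W₀.density x y : ℝ≥0∞) * ENNReal.ofReal (Real.exp (∑ j, θ ⟨x, j⟩ * g x j y)) ∂μ

/-- The potential (cumulant generating function) `φ_x`. -/
def potential (W₀ : Channel d μ) (g : (x : Fin d) → Fin (k x) → 𝒴 → ℝ) (x : Fin d)
    (θ : Param k) : ℝ :=
  Real.log (mgfAt W₀ g x θ).toReal

/-- Condition A: `{W_θ}_{θ ∈ Θ}` is an exponential family of channels. For `Θ` open or convex the
last clause, with `U = Θ`, says that the potentials are finite and `C²` on `Θ`; for any other `Θ`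
it says what is meant by `C²` on `Θ`. -/
def ConditionA (Θ : Set (Param k)) (W : Param k → Channel d μ) : Prop :=
  ∃ (W₀ : Channel d μ) (g : (x : Fin d) → Fin (k x) → 𝒴 → ℝ),
    (∀ x j, Measurable (g x j)) ∧
    (∀ θ ∈ Θ, ∀ x, ∀ᵐ y ∂μ, ((W θ).density x y : ℝ) =
      W₀.density x y * Real.exp (∑ j, θ ⟨x, j⟩ * g x j y - potential W₀ g x θ)) ∧
    ∃ U : Set (Param k), Θ ⊆ U ∧ (IsOpen U ∨ Convex ℝ U) ∧
      ∀ x, (∀ θ ∈ U, mgfAt W₀ g x θ < ∞) ∧ ContDiffOn ℝ 2 (potential W₀ g x) U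

/-- The Fisher information matrix `J_{θ,x} = ∫ W_{θ,x}(y) l_{θ,x}(y) l_{θ,x}(y)ᵀ dy` of the
likelihood ratio derivative `l`. -/
def fisherMatrix (W : Param k → Channel d μ) (x : Fin d) (l : Param k → 𝒴 → Param k)
    (θ : Param k) : Matrix (Σ x : Fin d, Fin (k x)) (Σ x : Fin d, Fin (k x)) ℝ :=
  Matrix.of fun a b => ∫ y, l θ y a * l θ y b ∂((W θ).law x)

/-- The regularity required by Conditions B and C, with uniformity on every member of `𝒦`:
for every input `x`, the likelihood ratio derivative `l_{θ,x} = ∇_θ log W_{θ,x}` exists and has a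
finite and continuous Fisher information matrix `J_{θ,x}`, and for every `s > 0` the divergence
`D_{1+s}(W_{θ,x} ‖ W_{θ',x})` is continuous in `(θ, θ')` and satisfies
`2 D_{1+s}(W_{θ,x} ‖ W_{θ+ε,x}) = (1 + s) εᵀ J_{θ,x} ε + o(‖ε‖²)` uniformly for `θ` in each
member of `𝒦`. -/
def LikelihoodRegular (Θ : Set (Param k)) (𝒦 : Set (Set (Param k)))
    (W : Param k → Channel d μ) : Prop :=
  ∀ x : Fin d, ∃ l : Param k → 𝒴 → Param k,
    (∀ θ ∈ Θ, ∀ᵐ y ∂((W θ).law x),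
      (∀ᶠ θ' in 𝓝[Θ] θ, 0 < (W θ').density x y) ∧
      HasGradientWithinAt (fun θ' => Real.log ((W θ').density x y : ℝ)) (l θ y) Θ θ) ∧
    (∀ θ ∈ Θ, MemLp (l θ) 2 ((W θ).law x)) ∧
    ContinuousOn (fisherMatrix W x l) Θ ∧
    ∀ s : ℝ, 0 < s →
      ContinuousOn (fun p : Param k × Param k =>
        renyiDiv μ s ((W p.1).density x) ((W p.2).density x)) (Θ ×ˢ Θ) ∧
      ∀ K ∈ 𝒦, ∀ η : ℝ, 0 < η → ∃ δ : ℝ, 0 < δ ∧ ∀ θ ∈ K, ∀ θ' ∈ Θ, ‖θ' - θ‖ < δ →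
        renyiDiv μ s ((W θ).density x) ((W θ').density x) ≠ ⊤ ∧
        |2 * (renyiDiv μ s ((W θ).density x) ((W θ').density x)).toReal
            - (1 + s) * ∑ a, ∑ b, (θ' a - θ a) * fisherMatrix W x l θ a b * (θ' b - θ b)|
          ≤ η * ‖θ' - θ‖ ^ 2

/-- Condition B: the parameter space is compact, and the regularity is uniform on it. -/
def ConditionB (Θ : Set (Param k)) (W : Param k → Channel d μ) : Prop :=
  IsCompact Θ ∧ LikelihoodRegular Θ {Θ} W

/-- Condition C: the parameter space is exhausted by an increasing sequence of compact subsets, and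
the regularity is uniform on every compact subset of it. -/
def ConditionC (Θ : Set (Param k)) (W : Param k → Channel d μ) : Prop :=
  (∃ Θs : ℕ → Set (Param k),
    (∀ i, IsCompact (Θs i) ∧ Θs i ⊆ Θ ∧ Θs i ⊆ Θs (i + 1)) ∧ ∀ θ ∈ Θ, ∃ i, θ ∈ Θs i) ∧
  LikelihoodRegular Θ {K | IsCompact K ∧ K ⊆ Θ} W

/-- A code of block length `n`: the number of messages, an encoder and a (measurable) decoder. -/
structure Code (d : ℕ) (𝒴 : Type*) [MeasurableSpace 𝒴] (n : ℕ) where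
  /-- the number of messages `M_n` -/
  size : ℕ
  /-- the encoder `E_n` -/
  enc : Fin size → Fin n → Fin d
  /-- the decoder `D_n` -/
  dec : (Fin n → 𝒴) → Fin size
  measurable_dec : Measurable dec

/-- The average decoding error probability
`(1 / M_n) ∑ i, ∑ j ≠ i, W^n_{E_n(i)} (D_n⁻¹(j))`. -/
def errorProb (W : Channel d μ) {n : ℕ} (Φ : Code d 𝒴 n) : ℝ :=
  (1 / (Φ.size : ℝ)) *
    ∑ i, ∑ j ∈ Finset.univ.filter (fun j => j ≠ i), (W.nLaw (Φ.enc i)).real (Φ.dec ⁻¹' {j})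

end UniversalCoding

end

open UniversalCoding

/-!
Universal codes for a family of channels, by random coding with a mixture decoder.

For block length `n` choose a finite net `N ⊆ Θ`, of size polynomial in `n`, that contains for every
`θ ∈ Θ` (once `n` is large) a point at distance `O(n⁻³)`. A word `y` is tested for the codeword `a`
by comparing `U_a(y) = ∑_{θ' ∈ N} ∏_t W_{θ', a_t}(y_t)` with a multiple `T · Q(y)` of its mean
`Q(y) = ∑_{θ' ∈ N} ∏_t (W_{θ'} · P)(y_t)` over codewords `a` drawn from `P^n`. By Markov's
inequality an independent codeword passes this test with probability at most `1 / T` for *every* `y`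
(`sum_indicator_decisionSet_le`), so the probability of confusion needs no knowledge of `θ`.

It remains to bound, under `W_θ`, the probability that the correct codeword fails its test. The
factor `U_a` is at least the density of the net point next to `θ`, and Markov's inequality under
`(W_θ · P)^n` shows that `Q` rarely exceeds `n |N|` times the density of `(W_θ · P)^n`. So, up to
vanishing probability, failure forces the information density sum `∑_t log (W_θ / W_θ · P)` below
`log T + O(log n)` (`Channel.IsClose.sum_nLaw_compl_decisionSet_le`). The slack `n^{1/4}` in the
code size absorbs the logarithms, and the central limit theorem gives the Gaussian bound.

One codebook must serve all `θ` at once. For the points of the net this follows from a second moment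
bound: the average failure probability over the `M` codewords has variance at most `1 / M`, and `M`
beats `|N|` (`exists_codebook`); when `M` does not grow it is `1` and no error is possible. Passing
from the net to `θ` costs `n` times the total variation distance of the single-letter laws.

Each of the three conditions is used only to show that the Hellinger affinity of `W_{θ,x}` and
`W_{θ',x}` is at least `1 - O(‖θ' - θ‖²)` near every `θ` (`locallyHellinger_of_condition`), which
makes the total variation distance `O(‖θ' - θ‖)`. For an exponential family the affinity is the
exponential of a midpoint second difference of the potential, and the midpoint of two points of a
convex set stays in the set; under the other two conditions the bound follows from the expansion of
the Rényi divergence of order `2`.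
-/

noncomputable section

namespace UniversalCoding

/-! ### Product measures and the central limit theorem -/

/-- Total variation is subadditive over products: the factors are exchanged one at a time. -/
lemma measure_pi_le_add {n : ℕ} {Y : Type*} [MeasurableSpace Y] (ε : ℝ≥0∞) :
    ∀ (μ ν : Fin n → Measure Y) [∀ t, IsProbabilityMeasure (μ t)]
      [∀ t, IsProbabilityMeasure (ν t)],
      (∀ t E, MeasurableSet E → μ t E ≤ ν t E + ε) →
      ∀ E, MeasurableSet E → Measure.pi μ E ≤ Measure.pi ν E + n * ε := by
  induction n with
  | zero =>
    intro μ ν _ _ _ E _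
    simp [Subsingleton.elim μ ν]
  | succ n ih =>
    intro μ ν _ _ h E hE
    let e := MeasurableEquiv.piFinSuccAbove (fun _ : Fin (n + 1) => Y) 0
    have key : ∀ (m : Fin (n + 1) → Measure Y) [∀ t, IsProbabilityMeasure (m t)],
        Measure.pi m E = ((m 0).prod (Measure.pi fun j => m (Fin.succAbove 0 j)))
          (e.symm ⁻¹' E) := by
      intro m _
      have := (measurePreserving_piFinSuccAbove m 0).symm
      exact (this.measure_preimage hE.nullMeasurableSet).symm
    have hE' : MeasurableSet (e.symm ⁻¹' E) := e.symm.measurable hE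
    rw [key μ, key ν]
    set μ' := Measure.pi fun j => μ (Fin.succAbove 0 j)
    set ν' := Measure.pi fun j => ν (Fin.succAbove 0 j)
    set F := e.symm ⁻¹' E
    calc ((μ 0).prod μ') F = ∫⁻ a, μ' (Prod.mk a ⁻¹' F) ∂(μ 0) := Measure.prod_apply hE'
      _ ≤ ∫⁻ a, (ν' (Prod.mk a ⁻¹' F) + n * ε) ∂(μ 0) :=
          lintegral_mono fun a =>
            ih _ _ (fun t E hE => h _ E hE) _ (measurable_prodMk_left hE')
      _ = ((μ 0).prod ν') F + n * ε := by
          rw [lintegral_add_right _ measurable_const, Measure.prod_apply hE']; simp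
      _ = ∫⁻ b, μ 0 ((fun a => (a, b)) ⁻¹' F) ∂ν' + n * ε := by
          rw [Measure.prod_apply_symm hE']
      _ ≤ ∫⁻ b, (ν 0 ((fun a => (a, b)) ⁻¹' F) + ε) ∂ν' + n * ε := by
          gcongr with b
          exact h 0 _ (measurable_prodMk_right hE')
      _ = ((ν 0).prod ν') F + (n + 1 : ℕ) * ε := by
          rw [lintegral_add_right _ measurable_const, Measure.prod_apply_symm hE']
          simp; ring

lemma lintegral_pi_prod {n : ℕ} {X : Type*} [MeasurableSpace X] (m : Measure X)
    [IsProbabilityMeasure m] (f : X → ℝ≥0∞) (hf : Measurable f) :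
    ∫⁻ z, ∏ t : Fin n, f (z t) ∂(Measure.pi fun _ : Fin n => m) = (∫⁻ x, f x ∂m) ^ n := by
  have hind := ProbabilityTheory.iIndepFun_pi (ι := Fin n) (μ := fun _ => m) (X := fun _ => f)
    (fun _ => hf.aemeasurable)
  rw [ProbabilityTheory.lintegral_prod_eq_prod_lintegral_of_indepFun Finset.univ
    (fun t (z : Fin n → X) => f (z t)) hind (fun t => hf.comp (measurable_pi_apply t))]
  simp_rw [(measurePreserving_eval (fun _ : Fin n => m) _).lintegral_comp hf]
  simp

/-- The joint law of an input of distribution `p` and the output of the channel `κ` for it. -/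
def jointLaw {A Y : Type*} [Fintype A] [MeasurableSpace A] [MeasurableSpace Y]
    (p : A → ℝ≥0∞) (κ : A → Measure Y) : Measure (A × Y) :=
  ∑ a, p a • (κ a).map (Prod.mk a)

section
variable {A Y : Type*} [Fintype A] [MeasurableSpace A] [MeasurableSpace Y]
    {p : A → ℝ≥0∞} {κ : A → Measure Y}

lemma jointLaw_apply {S : Set (A × Y)} (hS : MeasurableSet S) :
    jointLaw p κ S = ∑ a, p a * κ a (Prod.mk a ⁻¹' S) := by
  simp [jointLaw, Measure.map_apply measurable_prodMk_left hS]

lemma lintegral_jointLaw {f : A × Y → ℝ≥0∞} (hf : Measurable f) :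
    ∫⁻ z, f z ∂(jointLaw p κ) = ∑ a, p a * ∫⁻ y, f (a, y) ∂(κ a) := by
  simp [jointLaw, lintegral_map hf measurable_prodMk_left]

lemma isProbabilityMeasure_jointLaw [∀ a, IsProbabilityMeasure (κ a)] (hp : ∑ a, p a = 1) :
    IsProbabilityMeasure (jointLaw p κ) :=
  ⟨by rw [jointLaw_apply MeasurableSet.univ]; simpa using hp⟩

/-- Disintegration of `n` independent input-output pairs along the input word. -/
lemma pi_jointLaw_apply [∀ a, IsProbabilityMeasure (κ a)] (hp : ∑ a, p a = 1) {n : ℕ}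
    {S : Set (Fin n → A × Y)} (hS : MeasurableSet S) :
    Measure.pi (fun _ : Fin n => jointLaw p κ) S =
      ∑ a : Fin n → A, (∏ t, p (a t)) *
        Measure.pi (fun t => κ (a t)) {y | (fun t => (a t, y t)) ∈ S} := by
  have := isProbabilityMeasure_jointLaw (κ := κ) hp
  have hmeas : ∀ a : Fin n → A, Measurable fun (y : Fin n → Y) (t : Fin n) => (a t, y t) := by
    intro a; fun_prop
  have : Measure.pi (fun _ : Fin n => jointLaw p κ) =
      ∑ a : Fin n → A, (∏ t, p (a t)) •
        (Measure.pi fun t => κ (a t)).map fun y t => (a t, y t) := by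
    refine (Measure.pi_eq fun s hs => ?_)
    have : ∀ a : Fin n → A, (fun (y : Fin n → Y) t => (a t, y t)) ⁻¹' (Set.univ.pi s) =
        Set.univ.pi fun t => Prod.mk (a t) ⁻¹' s t := by
      intro a; ext y; simp [Set.mem_pi]
    simp only [Measure.coe_finsetSum, Finset.sum_apply, Measure.smul_apply, smul_eq_mul,
      Measure.map_apply (hmeas _) (MeasurableSet.univ_pi hs), this, Measure.pi_pi,
      jointLaw_apply (hs _), Finset.prod_univ_sum, Finset.prod_mul_distrib,
      Fintype.piFinset_univ]
  rw [this]
  simp [Measure.map_apply (hmeas _) hS]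
  rfl

end

open ProbabilityTheory in
/-- The central limit theorem as convergence of distribution functions, for product measures on
`Fin n → X` that need not be realised on one probability space. -/
lemma tendsto_pi_sum_le {X : Type*} [MeasurableSpace X] (m : Measure X) [IsProbabilityMeasure m]
    (f : X → ℝ) (hf : Measurable f) (hL : MemLp f 2 m) (hv : 0 < Var[f; m]) (c : ℝ) :
    Tendsto (fun n : ℕ => (Measure.pi fun _ : Fin n => m).real
      {z | ∑ t, f (z t) ≤ n * m[f] + √n * c}) atTop
      (𝓝 ((gaussianReal 0 1).real (Set.Iic (c / √Var[f; m])))) := by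
  let Q := Measure.infinitePi fun _ : ℕ => m
  let Xs : ℕ → (ℕ → X) → ℝ := fun i ω => f (ω i)
  have hmp : ∀ i, MeasurePreserving (fun ω : ℕ → X => ω i) Q m := fun i =>
    measurePreserving_eval_infinitePi (fun _ : ℕ => m) i
  have hind : iIndepFun Xs Q := iIndepFun_infinitePi (X := fun _ => f) (fun _ => hf)
  have hident : ∀ i, IdentDistrib (Xs i) (Xs 0) Q Q := fun i =>
    ⟨(hf.comp (measurable_pi_apply i)).aemeasurable, (hf.comp (measurable_pi_apply 0)).aemeasurable,
      by
        have h : ∀ i, Q.map (Xs i) = m.map f := fun i => by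
          rw [← (hmp i).map_eq, Measure.map_map hf (hmp i).measurable]; rfl
        rw [h, h]⟩
  have hmap : ∀ i, Q.map (Xs i) = m.map f := fun i => by
    rw [← (hmp i).map_eq, Measure.map_map hf (hmp i).measurable]; rfl
  have hmean : Q[Xs 0] = m[f] := by
    rw [← (hmp 0).map_eq, integral_map (hmp 0).measurable.aemeasurable
      hf.aestronglyMeasurable]
  have hvar : Var[Xs 0; Q] = Var[f; m] := by
    have hX0 : AEMeasurable (Xs 0) Q := (hf.comp (hmp 0).measurable).aemeasurable
    rw [← variance_id_map hX0, hmap, variance_id_map hf.aemeasurable]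
  set v := Var[f; m] with hv'
  have hsv : 0 < √v := Real.sqrt_pos.2 hv
  have hY : HasLaw (fun ω : ℝ => √v * ω) (gaussianReal 0 Var[Xs 0; Q].toNNReal)
      (gaussianReal 0 1) := by
    refine ⟨by fun_prop, ?_⟩
    rw [gaussianReal_map_const_mul, hvar]
    congr 1
    · simp
    · ext; simp [hv.le]
  have hL' : MemLp (Xs 0) 2 Q := hL.comp_measurePreserving (hmp 0)
  have hclt := (tendstoInDistribution_inv_sqrt_mul_sum_sub hY hL' hind hident).tendsto
  have hfr : ((gaussianReal 0 1).map (fun ω : ℝ => √v * ω)) (frontier (Set.Iic c)) = 0 := by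
    rw [frontier_Iic, Measure.map_apply (by fun_prop) (measurableSet_singleton c)]
    have : (fun ω : ℝ => √v * ω) ⁻¹' {c} = {c / √v} := by
      ext ω; simp [eq_div_iff hsv.ne', mul_comm]
    rw [this]
    have := nullSingletonClass_gaussianReal (μ := 0) (v := 1) one_ne_zero
    exact measure_singleton _
  have h1 := ProbabilityMeasure.tendsto_measure_of_null_frontier_of_tendsto' hclt hfr
  have hlim : (((gaussianReal 0 1).map (fun ω : ℝ => √v * ω)) (Set.Iic c)).toReal =
      (gaussianReal 0 1).real (Set.Iic (c / √v)) := by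
    rw [Measure.map_apply (by fun_prop) measurableSet_Iic, measureReal_def]
    congr 2
    ext ω; simp [le_div_iff₀ hsv, mul_comm]
  have hG : IsProbabilityMeasure ((gaussianReal 0 1).map (fun ω : ℝ => √v * ω)) :=
    Measure.isProbabilityMeasure_map (by fun_prop)
  have h2 := (ENNReal.tendsto_toReal (measure_ne_top
    ((gaussianReal 0 1).map (fun ω : ℝ => √v * ω)) (Set.Iic c))).comp h1
  rw [← hlim]
  refine h2.congr' ?_
  filter_upwards [eventually_gt_atTop 0] with n hn
  have hrn : 0 < √(n : ℝ) := Real.sqrt_pos.2 (by exact_mod_cast hn)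
  have hXm : Measurable fun ω => (√(n : ℝ))⁻¹ * (∑ k ∈ Finset.range n, Xs k ω - n * Q[Xs 0]) := by
    have : ∀ k, Measurable (Xs k) := fun k => hf.comp (measurable_pi_apply k)
    fun_prop
  simp only [Function.comp_apply, ProbabilityMeasure.coe_mk]
  rw [Measure.map_apply hXm measurableSet_Iic, measureReal_def]
  -- the first `n` coordinates of the infinite product have the law in the statement
  have hpi : Measure.pi (fun _ : Fin n => m) = Q.map (fun ω (t : Fin n) => ω t) := by
    rw [Measure.map_infinitePi_infinitePi_of_inj (P := fun _ : ℕ => m) Fin.val_injective,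
      Measure.infinitePi_eq_pi]
  rw [hpi, Measure.map_apply (by fun_prop)
    (measurableSet_le (by fun_prop) measurable_const)]
  congr 2
  ext ω
  simp only [Set.mem_preimage, Set.mem_Iic, Set.mem_ofPred_eq, hmean]
  rw [inv_mul_le_iff₀ hrn, sub_le_iff_le_add', Finset.sum_range]

/-! ### One-shot random coding -/

/-- The decoder that returns the first `i` with `y ∈ S i`. It errs on message `i` only if `y ∉ S i`
or `y` lies in another set of the family. -/
lemma exists_decoder {B : Type*} [MeasurableSpace B] {M : ℕ} (hM : 0 < M) (S : Fin M → Set B)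
    (hS : ∀ i, MeasurableSet (S i)) :
    ∃ dec : B → Fin M, Measurable dec ∧
      ∀ i, {y | dec y ≠ i} ⊆ (S i)ᶜ ∪ ⋃ i' ∈ Finset.univ.erase i, S i' := by
  classical
  -- the alternative `j = M - 1` makes the search terminate; it does not disturb earlier hits
  let q : B → ℕ → Prop := fun y j => (∃ h : j < M, y ∈ S ⟨j, h⟩) ∨ j = M - 1
  have hq : ∀ y, ∃ j, q y j := fun y => ⟨M - 1, Or.inr rfl⟩
  have hqm : ∀ j, MeasurableSet {y | q y j} := by
    intro j
    by_cases hj : j < M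
    · have : {y | q y j} = S ⟨j, hj⟩ ∪ {_y | j = M - 1} := by
        ext y; simp [q, hj]
      rw [this]; exact (hS _).union (MeasurableSet.const _)
    · have : {y | q y j} = {_y | j = M - 1} := by
        ext y; simp [q, hj]
      rw [this]; exact MeasurableSet.const _
  have hlt : ∀ y, Nat.find (hq y) < M := fun y =>
    lt_of_le_of_lt (Nat.find_min' (hq y) (Or.inr rfl)) (Nat.sub_lt hM one_pos)
  let e : ℕ → Fin M := fun j => if h : j < M then ⟨j, h⟩ else ⟨0, hM⟩
  have hdec : ∀ y, ((e (Nat.find (hq y)) : Fin M) : ℕ) = Nat.find (hq y) := fun y => by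
    simp [e, hlt y]
  refine ⟨fun y => e (Nat.find (hq y)),
    (measurable_from_nat (f := e)).comp (measurable_find hq hqm), fun i y hy => ?_⟩
  by_contra hcon
  simp only [Set.mem_union, Set.mem_compl_iff, Finset.mem_erase, Finset.mem_univ, and_true,
    Set.mem_iUnion, exists_prop, not_or, not_not, not_exists, not_and] at hcon
  obtain ⟨h1, h2⟩ := hcon
  apply hy
  apply Fin.ext
  rw [hdec]
  have hle : Nat.find (hq y) ≤ i := Nat.find_min' (hq y) (Or.inl ⟨i.2, h1⟩)
  rcases Nat.find_spec (hq y) with ⟨h, hs⟩ | h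
  · by_contra hne
    exact h2 ⟨_, h⟩ (fun h' => hne (congrArg Fin.val h')) hs
  · have := i.2; omega

/-- Random coding with `M` independent codewords of distribution `p`. If an independent codeword is
accepted with probability at most `τ` for every output, then some codebook satisfies the bounds of
the ensemble simultaneously for a finite family of channels: the average rejection probability of
the sent codeword concentrates by a variance bound, and the average acceptance probability of the
other codewords is controlled by its mean. -/
lemma exists_codebook {A B J : Type*} [Fintype A] [MeasurableSpace B] [Fintype J]
    (p : A → ℝ≥0∞) (hp : ∑ a, p a = 1) (V : J → A → Measure B)
    [∀ j a, IsProbabilityMeasure (V j a)] (S : A → Set B) (hS : ∀ a, MeasurableSet (S a))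
    {τ : ℝ} (hτ0 : 0 ≤ τ)
    (hτ : ∀ y, ∑ a, p a * (S a).indicator 1 y ≤ ENNReal.ofReal τ) {M : ℕ} (hM : 0 < M) :
    ∃ c : Fin M → A, ∀ j,
      (1 / (M : ℝ)) * ∑ i, (V j (c i)).real (S (c i))ᶜ ≤
        ∑ a, (p a).toReal * (V j a).real (S a)ᶜ +
          √(Fintype.card J * (1 / M + M * τ)) ∧
      (1 / (M : ℝ)) * ∑ i, ∑ i' ∈ Finset.univ.erase i, (V j (c i)).real (S (c i')) ≤
          Fintype.card J * (1 / M + M * τ) := by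
  classical
  let _ : MeasurableSpace A := ⊤
  have : DiscreteMeasurableSpace A := ⟨fun _ => trivial⟩
  let m : Measure A := (PMF.ofFintype p hp).toMeasure
  let Q : Measure (Fin M → A) := Measure.pi fun _ => m
  have hMr : (0 : ℝ) < M := by exact_mod_cast hM
  have hint : ∀ f : A → ℝ, ∫ a, f a ∂m = ∑ a, (p a).toReal * f a := fun f => by
    rw [PMF.integral_eq_sum]; simp
  have hIntQ : ∀ F : (Fin M → A) → ℝ, Integrable F Q := fun F => Integrable.of_finite
  let g : J → A → ℝ := fun j a => (V j a).real (S a)ᶜ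
  let h : J → A → A → ℝ := fun j a a' => (V j a).real (S a')
  let α : J → ℝ := fun j => ∑ a, (p a).toReal * g j a
  let G : J → (Fin M → A) → ℝ := fun j c => (1 / (M : ℝ)) * ∑ i, g j (c i)
  let H : J → (Fin M → A) → ℝ := fun j c =>
    (1 / (M : ℝ)) * ∑ i, ∑ i' ∈ Finset.univ.erase i, h j (c i) (c i')
  have hG : ∀ j, ∫ c, (G j c - α j) ^ 2 ∂Q ≤ 1 / (M : ℝ) := by
    intro j
    have hmean : ∫ c, G j c ∂Q = α j := by
      simp only [G]
      rw [integral_const_mul, integral_finsetSum _ fun i _ => hIntQ _]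
      have : ∀ i : Fin M, ∫ c, g j (c i) ∂Q = α j := fun i => by
        refine Eq.trans ?_ (hint (g j))
        exact integral_comp_eval (μ := fun _ : Fin M => m) (i := i) (f := g j)
          (Measurable.of_discrete.aestronglyMeasurable)
      simp only [this]
      simp; field_simp
    have hvar : ProbabilityTheory.variance (G j) Q = ∫ c, (G j c - α j) ^ 2 ∂Q := by
      rw [ProbabilityTheory.variance_eq_integral (hIntQ _).aemeasurable, hmean]
    rw [← hvar]
    have h1 : ProbabilityTheory.variance (G j) Q = (1 / (M : ℝ)) ^ 2 *
        ∑ i : Fin M, ProbabilityTheory.variance (g j) m := by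
      have := ProbabilityTheory.variance_sum_pi (μ := fun _ : Fin M => m)
        (X := fun _ => g j) (fun _ => MemLp.of_discrete)
      rw [← this, ← ProbabilityTheory.variance_const_mul]
      congr 1
      ext c; simp [G]
    have h2 : ProbabilityTheory.variance (g j) m ≤ 1 := by
      have := ProbabilityTheory.variance_le_sq_of_bounded (μ := m) (X := g j) (a := 0) (b := 1)
        (ae_of_all _ fun a => ⟨measureReal_nonneg, measureReal_le_one⟩)
        (Measurable.of_discrete.aemeasurable)
      refine this.trans (by norm_num)
    rw [h1]
    simp only [Finset.sum_const, Finset.card_univ, Fintype.card_fin, nsmul_eq_mul]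
    calc (1 / (M : ℝ)) ^ 2 * (M * ProbabilityTheory.variance (g j) m)
        ≤ (1 / (M : ℝ)) ^ 2 * (M * 1) := by gcongr
      _ = 1 / (M : ℝ) := by field_simp
  have hh : ∀ j a, ∑ a', (p a').toReal * h j a a' ≤ τ := by
    intro j a
    have h1 : ∑ a', p a' * V j a (S a') ≤ ENNReal.ofReal τ := by
      calc ∑ a', p a' * V j a (S a') = ∫⁻ y, ∑ a', p a' * (S a').indicator 1 y ∂(V j a) := by
            rw [lintegral_finsetSum _ fun a' _ =>
              (measurable_one.indicator (hS a')).const_mul _]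
            refine Finset.sum_congr rfl fun a' _ => ?_
            rw [lintegral_const_mul _ (measurable_one.indicator (hS a')),
              lintegral_indicator_one (hS a')]
        _ ≤ ∫⁻ y, ENNReal.ofReal τ ∂(V j a) := lintegral_mono hτ
        _ = ENNReal.ofReal τ := by simp
    have hpne : ∀ a, p a ≠ ∞ := fun a => ((Finset.single_le_sum (f := p)
      (fun _ _ => zero_le) (Finset.mem_univ a)).trans_lt (by simp [hp])).ne
    have h2 := ENNReal.toReal_mono ENNReal.ofReal_ne_top h1
    rw [ENNReal.toReal_ofReal hτ0, ENNReal.toReal_sum fun a' _ =>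
      ENNReal.mul_ne_top (hpne a') (measure_ne_top _ _)] at h2
    simpa [ENNReal.toReal_mul, h, measureReal_def] using h2
  have hpair : ∀ j, ∀ i i' : Fin M, i' ≠ i → ∫ c, h j (c i) (c i') ∂Q ≤ τ := by
    intro j i i' hii
    have hmap : Q.map (fun c => (c i, c i')) = m.prod m := by
      simp only [Q]
      rw [← Measure.infinitePi_eq_pi]
      exact Measure.infinitePi_map_eval_prod (P := fun _ : Fin M => m) hii.symm
    have : ∫ c, h j (c i) (c i') ∂Q = ∫ z, h j z.1 z.2 ∂(m.prod m) := by
      rw [← hmap, integral_map (Measurable.of_discrete.aemeasurable)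
        (Measurable.of_discrete.aestronglyMeasurable)]
    rw [this, integral_prod _ Integrable.of_finite]
    simp only [hint]
    calc ∑ a, (p a).toReal * ∑ a', (p a').toReal * h j a a' ≤ ∑ a, (p a).toReal * τ := by
          gcongr with a; exact hh j a
      _ = τ := by
          rw [← Finset.sum_mul, ← ENNReal.toReal_sum, hp]; simp
          intro a _
          exact ((Finset.single_le_sum (f := p)
            (fun _ _ => zero_le) (Finset.mem_univ a)).trans_lt (by simp [hp])).ne
  have hH : ∀ j, ∫ c, H j c ∂Q ≤ M * τ := by
    intro j
    simp only [H]
    rw [integral_const_mul, integral_finsetSum _ fun i _ => hIntQ _]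
    calc (1 / (M : ℝ)) * ∑ i, ∫ c, ∑ i' ∈ Finset.univ.erase i, h j (c i) (c i') ∂Q
        ≤ (1 / (M : ℝ)) * ∑ i : Fin M, (M : ℝ) * τ := by
          gcongr with i
          rw [integral_finsetSum _ fun i _ => hIntQ _]
          calc ∑ i' ∈ Finset.univ.erase i, ∫ c, h j (c i) (c i') ∂Q
              ≤ ∑ i' ∈ Finset.univ.erase i, τ :=
                Finset.sum_le_sum fun i' hi' => hpair j i i' (Finset.ne_of_mem_erase hi')
            _ ≤ ∑ i' : Fin M, τ := Finset.sum_le_sum_of_subset_of_nonneg (Finset.erase_subset _ _)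
                fun _ _ _ => hτ0
            _ = M * τ := by simp
      _ = M * τ := by simp; field_simp
  -- a single nonnegative functional whose mean is small controls both kinds of error for all `j`
  obtain ⟨c, hc⟩ := exists_le_integral (μ := Q)
    (f := fun c => ∑ j, ((G j c - α j) ^ 2 + H j c)) (hIntQ _)
  have hbound : ∑ j, ((G j c - α j) ^ 2 + H j c) ≤ Fintype.card J * (1 / M + M * τ) := by
    refine hc.trans ?_
    rw [integral_finsetSum _ fun i _ => hIntQ _]
    calc ∑ j, ∫ c, ((G j c - α j) ^ 2 + H j c) ∂Q ≤ ∑ j : J, (1 / (M : ℝ) + M * τ) := by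
          gcongr with j
          rw [integral_add (hIntQ _) (hIntQ _)]
          exact add_le_add (hG j) (hH j)
      _ = _ := by simp [mul_add]
  have hHnn : ∀ j, 0 ≤ H j c := fun j => by
    simp only [H, h]; positivity
  refine ⟨c, fun j => ?_⟩
  have hj : (G j c - α j) ^ 2 + H j c ≤ Fintype.card J * (1 / M + M * τ) :=
    (Finset.single_le_sum (f := fun j => (G j c - α j) ^ 2 + H j c)
      (fun j _ => add_nonneg (sq_nonneg _) (hHnn j)) (Finset.mem_univ j)).trans hbound
  constructor
  · have := Real.le_sqrt_of_sq_le (le_trans (le_add_of_nonneg_right (hHnn j)) hj)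
    show G j c ≤ α j + _
    linarith
  · exact le_trans (le_add_of_nonneg_left (sq_nonneg _)) hj

/-- One-shot universal coding for a finite family of channels. -/
lemma exists_code {A B J : Type*} [Fintype A] [MeasurableSpace B] [Fintype J]
    (p : A → ℝ≥0∞) (hp : ∑ a, p a = 1) (V : J → A → Measure B)
    [∀ j a, IsProbabilityMeasure (V j a)] (S : A → Set B) (hS : ∀ a, MeasurableSet (S a))
    {τ : ℝ} (hτ0 : 0 ≤ τ)
    (hτ : ∀ y, ∑ a, p a * (S a).indicator 1 y ≤ ENNReal.ofReal τ) {M : ℕ} (hM : 0 < M) :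
    ∃ (c : Fin M → A) (dec : B → Fin M), Measurable dec ∧ ∀ j,
      (1 / (M : ℝ)) * ∑ i, (V j (c i)).real {y | dec y ≠ i} ≤
        ∑ a, (p a).toReal * (V j a).real (S a)ᶜ +
          √(Fintype.card J * (1 / M + M * τ)) + Fintype.card J * (1 / M + M * τ) := by
  obtain ⟨c, hc⟩ := exists_codebook p hp V S hS hτ0 hτ hM
  obtain ⟨dec, hdm, hdec⟩ := exists_decoder hM (fun i => S (c i)) (fun i => hS _)
  refine ⟨c, dec, hdm, fun j => ?_⟩
  have : ∀ i, (V j (c i)).real {y | dec y ≠ i} ≤ (V j (c i)).real (S (c i))ᶜ +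
      ∑ i' ∈ Finset.univ.erase i, (V j (c i)).real (S (c i')) := fun i =>
    (measureReal_mono (hdec i)).trans <| (measureReal_union_le _ _).trans <| by
      gcongr
      exact measureReal_biUnion_finset_le _ _
  calc (1 / (M : ℝ)) * ∑ i, (V j (c i)).real {y | dec y ≠ i}
      ≤ (1 / (M : ℝ)) * ∑ i, ((V j (c i)).real (S (c i))ᶜ +
        ∑ i' ∈ Finset.univ.erase i, (V j (c i)).real (S (c i'))) := by
        gcongr with i; exact this i
    _ = _ := by rw [Finset.sum_add_distrib, mul_add]
    _ ≤ _ := add_le_add (hc j).1 (hc j).2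

variable {d : ℕ} {𝒴 : Type*} [MeasurableSpace 𝒴] {μ : Measure 𝒴} {k : Fin d → ℕ}

/-! ### Hellinger affinity and the regularity conditions -/

/-- The Hellinger affinity `∫ √(p q) dμ` of two densities. -/
def affinity (μ : Measure 𝒴) (p q : 𝒴 → ℝ≥0) : ℝ≥0∞ :=
  ∫⁻ y, (NNReal.sqrt (p y * q y) : ℝ≥0∞) ∂μ

lemma law_apply (W : Channel d μ) (x : Fin d) {E : Set 𝒴} (hE : MeasurableSet E) :
    W.law x E = ∫⁻ y in E, W.density x y ∂μ := withDensity_apply _ hE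

/-- An affinity of at least `1 - c s²` bounds the total variation distance by `(c + 2) s`. This is
`p - q = (√p - √q) (√p + √q)` together with the arithmetic-geometric mean inequality weighted by
`s`, in place of the Cauchy-Schwarz inequality. -/
lemma law_le_add_of_affinity (W W' : Channel d μ) (x : Fin d) {c s : ℝ} (hc : 0 ≤ c) (hs : 0 < s)
    (h : ENNReal.ofReal (1 - c * s ^ 2) ≤ affinity μ (W.density x) (W'.density x))
    {E : Set 𝒴} (hE : MeasurableSet E) :
    W.law x E ≤ W'.law x E + ENNReal.ofReal ((c + 2) * s) := by
  set p := W.density x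
  set q := W'.density x
  have hp : Measurable p := W.measurable_density x
  have hq : Measurable q := W'.measurable_density x
  have hroot : Measurable fun y => NNReal.sqrt (p y * q y) :=
    NNReal.continuous_sqrt.measurable.comp (hp.mul hq)
  have hsqrt : ∀ y, ((NNReal.sqrt (p y * q y) : ℝ≥0) : ℝ) = √(p y : ℝ) * √(q y : ℝ) := fun y => by
    rw [Real.coe_sqrt, NNReal.coe_mul, Real.sqrt_mul (p y).coe_nonneg]
  -- arithmetic-geometric mean inequalities for the densities, the first one on `E`
  have h1 : ∀ y, 2 * s.toNNReal * p y + 2 * NNReal.sqrt (p y * q y) ≤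
      2 * s.toNNReal * q y + (p y + q y) + 2 * s.toNNReal ^ 2 * (p y + q y) := fun y => by
    rw [← NNReal.coe_le_coe]
    simp only [NNReal.coe_add, NNReal.coe_mul, NNReal.coe_pow, NNReal.coe_ofNat, hsqrt,
      Real.coe_toNNReal s hs.le]
    nlinarith [Real.sq_sqrt (p y).coe_nonneg, Real.sq_sqrt (q y).coe_nonneg,
      sq_nonneg ((√(p y : ℝ) - √(q y : ℝ)) - s * (√(p y : ℝ) + √(q y : ℝ))),
      sq_nonneg (s * (√(p y : ℝ) - √(q y : ℝ)))]
  have h2 : ∀ y, 2 * NNReal.sqrt (p y * q y) ≤ p y + q y := fun y => by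
    rw [← NNReal.coe_le_coe]
    simp only [NNReal.coe_add, NNReal.coe_mul, NNReal.coe_ofNat, hsqrt]
    nlinarith [Real.sq_sqrt (p y).coe_nonneg, Real.sq_sqrt (q y).coe_nonneg,
      sq_nonneg (√(p y : ℝ) - √(q y : ℝ))]
  have hlin : ∀ (F : Set 𝒴) (u v : ℝ≥0), MeasurableSet F →
      ∫⁻ y in F, (u * p y + v * q y : ℝ≥0) ∂μ = u * W.law x F + v * W'.law x F := by
    intro F u v hF
    simp only [ENNReal.coe_add, ENNReal.coe_mul]
    rw [lintegral_add_left (by fun_prop), lintegral_const_mul _ (by fun_prop),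
      lintegral_const_mul _ (by fun_prop), law_apply W x hF, law_apply W' x hF]
  have hI1 : 2 * s.toNNReal * W.law x E + 2 * ∫⁻ y in E, NNReal.sqrt (p y * q y) ∂μ ≤
      2 * s.toNNReal * W'.law x E + (W.law x E + W'.law x E) +
        2 * s.toNNReal ^ 2 * (W.law x E + W'.law x E) := by
    have := lintegral_mono (μ := μ.restrict E) fun y => ENNReal.coe_le_coe.2 (h1 y)
    have e1 : ∀ y, 2 * s.toNNReal * q y + (p y + q y) + 2 * s.toNNReal ^ 2 * (p y + q y) =
        (1 + 2 * s.toNNReal ^ 2) * p y + (2 * s.toNNReal + 1 + 2 * s.toNNReal ^ 2) * q y :=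
      fun y => by ring
    simp only [e1, hlin _ _ _ hE, ENNReal.coe_add (2 * s.toNNReal * p _),
      ENNReal.coe_mul 2 (NNReal.sqrt _)] at this
    rw [lintegral_add_right _ (by fun_prop), lintegral_const_mul _ (by fun_prop)] at this
    simp only [ENNReal.coe_mul (2 * s.toNNReal)] at this
    rw [lintegral_const_mul _ (by fun_prop), ← law_apply W x hE] at this
    push_cast at this
    refine this.trans (le_of_eq ?_)
    ring
  have hI2 : 2 * ∫⁻ y in Eᶜ, NNReal.sqrt (p y * q y) ∂μ ≤ W.law x Eᶜ + W'.law x Eᶜ := by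
    have := lintegral_mono (μ := μ.restrict Eᶜ) fun y => ENNReal.coe_le_coe.2 (h2 y)
    have e1 : ∀ y, p y + q y = 1 * p y + 1 * q y := fun y => by ring
    simp only [e1, hlin _ _ _ hE.compl, ENNReal.coe_mul 2 (NNReal.sqrt _)] at this
    rw [lintegral_const_mul _ (by fun_prop)] at this
    simpa using this
  have hA : affinity μ p q = ∫⁻ y in E, NNReal.sqrt (p y * q y) ∂μ +
      ∫⁻ y in Eᶜ, NNReal.sqrt (p y * q y) ∂μ := (lintegral_add_compl _ hE).symm
  have hA1 : ∫⁻ y in E, (NNReal.sqrt (p y * q y) : ℝ≥0∞) ∂μ ≠ ∞ := fun h => by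
    rw [h] at hI1
    revert hI1
    simp [ENNReal.mul_eq_top, ENNReal.add_eq_top]
  have hA2 : ∫⁻ y in Eᶜ, (NNReal.sqrt (p y * q y) : ℝ≥0∞) ∂μ ≠ ∞ := fun h => by
    rw [h] at hI2
    revert hI2
    simp [ENNReal.add_eq_top]
  rw [hA] at h
  have hc1 := prob_add_prob_compl (μ := W.law x) hE
  have hc2 := prob_add_prob_compl (μ := W'.law x) hE
  generalize ∫⁻ y in E, (NNReal.sqrt (p y * q y) : ℝ≥0∞) ∂μ = a at *
  generalize ∫⁻ y in Eᶜ, (NNReal.sqrt (p y * q y) : ℝ≥0∞) ∂μ = b at *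
  have f1 : W.law x E ≠ ∞ := measure_ne_top _ _
  have f2 : W'.law x E ≠ ∞ := measure_ne_top _ _
  have f3 : W.law x Eᶜ ≠ ∞ := measure_ne_top _ _
  have f4 : W'.law x Eᶜ ≠ ∞ := measure_ne_top _ _
  generalize W.law x E = w at *
  generalize W'.law x E = w' at *
  generalize W.law x Eᶜ = v at *
  generalize W'.law x Eᶜ = v' at *
  lift a to ℝ≥0 using hA1
  lift b to ℝ≥0 using hA2
  lift w to ℝ≥0 using f1
  lift w' to ℝ≥0 using f2
  lift v to ℝ≥0 using f3
  lift v' to ℝ≥0 using f4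
  simp only [ENNReal.ofReal] at h ⊢
  norm_cast at h hI1 hI2 hc1 hc2 ⊢
  rw [Real.toNNReal_le_iff_le_coe] at h
  rw [← NNReal.coe_le_coe] at hI1 hI2 ⊢
  rw [← NNReal.coe_inj] at hc1 hc2
  push_cast at h hI1 hI2 hc1 hc2 ⊢
  rw [Real.coe_toNNReal _ (by positivity)]
  rw [Real.coe_toNNReal s hs.le] at hI1
  have : 2 * s * (w : ℝ) ≤ 2 * s * (w' + (c + 2) * s) := by
    nlinarith [sq_nonneg s, w.2, w'.2, v.2, v'.2, mul_nonneg (sq_nonneg s) v.2,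
      mul_nonneg (sq_nonneg s) v'.2]
  exact le_of_mul_le_mul_left this (by positivity)

/-- The affinity is bounded below in terms of the Rényi divergence of order `2`: pointwise,
`3 p ≤ 2 √(p q) + p² / q`. -/
lemma three_le_two_mul_affinity_add (W W' : Channel d μ) (x : Fin d) :
    3 ≤ 2 * affinity μ (W.density x) (W'.density x) +
      ∫⁻ y, (W.density x y : ℝ≥0∞) ^ (1 + 1 : ℝ) * (W'.density x y : ℝ≥0∞) ^ (-1 : ℝ) ∂μ := by
  have hp : Measurable (W.density x) := W.measurable_density x
  have hq : Measurable (W'.density x) := W'.measurable_density x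
  have key : ∀ p q : ℝ≥0, (3 * p : ℝ≥0∞) ≤
      2 * (NNReal.sqrt (p * q) : ℝ≥0) + (p : ℝ≥0∞) ^ (1 + 1 : ℝ) * (q : ℝ≥0∞) ^ (-1 : ℝ) := by
    intro p q
    rw [one_add_one_eq_two, ENNReal.rpow_neg_one, ENNReal.rpow_two]
    rcases eq_or_ne p 0 with rfl | hp0
    · simp
    rcases eq_or_ne q 0 with rfl | hq0
    · simp [hp0]
    rw [← ENNReal.coe_inv hq0]
    norm_cast
    rw [← NNReal.coe_le_coe]
    push_cast
    rw [Real.sqrt_mul p.coe_nonneg]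
    set a := √(p : ℝ)
    set b := √(q : ℝ)
    have ha : (p : ℝ) = a ^ 2 := (Real.sq_sqrt p.coe_nonneg).symm
    have hb : (q : ℝ) = b ^ 2 := (Real.sq_sqrt q.coe_nonneg).symm
    have hb0 : 0 < b := Real.sqrt_pos.2 (by positivity)
    have ha0 : 0 ≤ a := Real.sqrt_nonneg _
    rw [ha, hb, ← sub_nonneg]
    have : 2 * (a * b) + (a ^ 2) ^ 2 * (b ^ 2)⁻¹ - 3 * a ^ 2 =
        a * (a - b) ^ 2 * (a + 2 * b) / b ^ 2 := by field_simp; ring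
    rw [this]; positivity
  have h3 : ∫⁻ y, 3 * (W.density x y : ℝ≥0∞) ∂μ = 3 := by
    rw [lintegral_const_mul _ (by fun_prop), W.lintegral_density, mul_one]
  rw [← h3, affinity, ← lintegral_const_mul _ (by fun_prop), ← lintegral_add_left (by fun_prop)]
  exact lintegral_mono fun y => key _ _

/-- The local regularity used by the coding argument: around every `θ ∈ Θ`, the squared Hellinger
distance to `W_{θ'}` is `O(‖θ' - θ‖²)`, with a constant that may depend on `θ`. -/
def LocallyHellinger (Θ : Set (Param k)) (W : Param k → Channel d μ) : Prop :=
  ∀ θ ∈ Θ, ∀ x, ∃ c : ℝ, 0 ≤ c ∧ ∀ᶠ θ' in 𝓝[Θ] θ,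
    ENNReal.ofReal (1 - c * ‖θ' - θ‖ ^ 2) ≤ affinity μ ((W θ).density x) ((W θ').density x)

lemma LikelihoodRegular.locallyHellinger {Θ : Set (Param k)} {𝒦 : Set (Set (Param k))}
    {W : Param k → Channel d μ} (h : LikelihoodRegular Θ 𝒦 W) (h𝒦 : ∀ θ ∈ Θ, ∃ K ∈ 𝒦, θ ∈ K) :
    LocallyHellinger Θ W := by
  intro θ hθ x
  obtain ⟨K, hK, hθK⟩ := h𝒦 θ hθ
  obtain ⟨l, -, -, -, hl⟩ := h x
  obtain ⟨δ, hδ, hexp⟩ := (hl 1 one_pos).2 K hK 1 one_pos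
  set A := fisherMatrix W x l θ
  set c : ℝ := ∑ a, ∑ b, |A a b|
  have hc : 0 ≤ c := by positivity
  have hquad : ∀ v : Param k, ∑ a, ∑ b, v a * A a b * v b ≤ c * ‖v‖ ^ 2 := by
    intro v
    rw [Finset.sum_mul]
    refine Finset.sum_le_sum fun a _ => ?_
    rw [Finset.sum_mul]
    refine Finset.sum_le_sum fun b _ => ?_
    calc v a * A a b * v b ≤ |v a * A a b * v b| := le_abs_self _
      _ = |A a b| * (‖v a‖ * ‖v b‖) := by rw [abs_mul, abs_mul]; simp; ring
      _ ≤ |A a b| * (‖v‖ * ‖v‖) := by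
          gcongr <;> exact PiLp.norm_apply_le v _
      _ = |A a b| * ‖v‖ ^ 2 := by ring
  set C := 2 * c + 1
  have hC : 0 < C := by positivity
  refine ⟨C, hC.le, ?_⟩
  have hball : Metric.ball θ (min δ (1 / (1 + C))) ∈ 𝓝[Θ] θ :=
    mem_nhdsWithin_of_mem_nhds (Metric.ball_mem_nhds _ (by positivity))
  filter_upwards [hball, self_mem_nhdsWithin] with θ' hθ' hmem
  rw [mem_ball_iff_norm, lt_min_iff] at hθ'
  obtain ⟨htop, hle⟩ := hexp θ hθK θ' hmem hθ'.1
  set D := renyiDiv μ 1 ((W θ).density x) ((W θ').density x) with hD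
  set t := ‖θ' - θ‖ ^ 2
  have ht0 : 0 ≤ t := sq_nonneg _
  have ht1 : C * t ≤ 1 := by
    have h1 : ‖θ' - θ‖ ≤ 1 := hθ'.2.le.trans (by rw [div_le_one (by positivity)]; linarith)
    have h2 : t ≤ 1 / (1 + C) := by
      calc t = ‖θ' - θ‖ * ‖θ' - θ‖ := pow_two _
        _ ≤ 1 * (1 / (1 + C)) := by gcongr; exact hθ'.2.le
        _ = _ := one_mul _
    calc C * t ≤ (1 + C) * (1 / (1 + C)) := by gcongr; linarith
      _ = 1 := by field_simp
  have hDle : D.toReal ≤ C * t := by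
    have := (abs_le.1 hle).2
    have hq := hquad (θ' - θ)
    simp only [PiLp.sub_apply] at hq
    simp only [C]
    nlinarith
  set I := ∫⁻ y, ((W θ).density x y : ℝ≥0∞) ^ (1 + 1 : ℝ) *
    ((W θ').density x y : ℝ≥0∞) ^ (-1 : ℝ) ∂μ with hI
  have hDI : D = ENNReal.log I := by
    rw [hD, renyiDiv]; simp [hI]
  have hIle : I ≤ ENNReal.ofReal (1 + 2 * (C * t)) := by
    have h1 : I = EReal.exp D := by rw [hDI, ENNReal.exp_log]
    rw [h1]
    have h2 : D ≤ ((C * t : ℝ) : EReal) := by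
      refine (EReal.le_coe_toReal htop).trans ?_
      exact_mod_cast hDle
    refine (EReal.exp_monotone h2).trans ?_
    rw [EReal.exp_coe]
    refine ENNReal.ofReal_le_ofReal ?_
    have := Real.abs_exp_sub_one_le (x := C * t) (by rw [abs_of_nonneg (by positivity)]; exact ht1)
    rw [abs_of_nonneg (by positivity : 0 ≤ C * t)] at this
    linarith [(abs_le.1 this).2]
  have h3 := three_le_two_mul_affinity_add (W θ) (W θ') x
  rcases eq_or_ne (affinity μ ((W θ).density x) ((W θ').density x)) ∞ with hA | hA
  · rw [hA]; exact le_top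
  have h4 := h3.trans (add_le_add_right hIle _)
  refine (ENNReal.ofReal_le_iff_le_toReal hA).2 ?_
  have h5 := ENNReal.toReal_mono
    (ENNReal.add_ne_top.2 ⟨ENNReal.mul_ne_top (by simp) hA, ENNReal.ofReal_ne_top⟩) h4
  rw [ENNReal.toReal_add (ENNReal.mul_ne_top (by simp) hA) ENNReal.ofReal_ne_top,
    ENNReal.toReal_mul, ENNReal.toReal_ofReal (by positivity)] at h5
  norm_num at h5
  linarith

/-- The midpoint second difference of a `C²` function on an open or convex set is bounded below by a
quadratic. The set may have empty interior, so the derivatives are taken within it, and the bound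
comes from the Lipschitz property of the first derivative on a convex neighbourhood of `a` in `U`.
-/
lemma exists_second_difference_bound {E : Type*} [NormedAddCommGroup E] [NormedSpace ℝ E]
    {U : Set E} (hU : IsOpen U ∨ Convex ℝ U) {f : E → ℝ} (hf : ContDiffOn ℝ 2 f U) {a : E}
    (ha : a ∈ U) :
    ∃ c : ℝ, 0 ≤ c ∧ ∀ᶠ b in 𝓝[U] a, midpoint ℝ a b ∈ U ∧
      -(c * ‖b - a‖ ^ 2) ≤ f (midpoint ℝ a b) - (f a + f b) / 2 := by
  -- an open set is replaced by a ball in it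
  wlog hconv : Convex ℝ U generalizing U
  · have hUo : IsOpen U := hU.resolve_right hconv
    obtain ⟨r, hr, hball⟩ := Metric.isOpen_iff.1 hUo a ha
    obtain ⟨c, hc, h⟩ := this (U := Metric.ball a r) (Or.inr (convex_ball _ _)) (hf.mono hball)
      (Metric.mem_ball_self hr) (convex_ball _ _)
    refine ⟨c, hc, ?_⟩
    rw [hUo.nhdsWithin_eq ha]
    rw [Metric.isOpen_ball.nhdsWithin_eq (Metric.mem_ball_self hr)] at h
    exact h.mono fun b hb => ⟨hball hb.1, hb.2⟩
  have h2 : ContDiffWithinAt ℝ (1 + 1) f U a := by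
    have := hf a ha
    rwa [one_add_one_eq_two]
  obtain ⟨u, hu, -, f', hf', hf'C⟩ :=
    (contDiffWithinAt_succ_iff_hasFDerivWithinAt (by simp)).1 h2
  rw [Set.insert_eq_of_mem ha] at hu
  obtain ⟨r, hr, hru⟩ := Metric.mem_nhdsWithin_iff.1 hu
  set s := Metric.ball a r ∩ U
  have hs : Convex ℝ s := (convex_ball _ _).inter hconv
  obtain ⟨K, t, ht, hK⟩ := (hf'C.mono hru).exists_lipschitzOnWith hs
  have hst : s ∈ 𝓝[U] a := Filter.inter_mem (mem_nhdsWithin_of_mem_nhds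
    (Metric.ball_mem_nhds a hr)) self_mem_nhdsWithin
  have ht' : t ∈ 𝓝[U] a := by
    rwa [nhdsWithin_inter_of_mem (mem_nhdsWithin_of_mem_nhds (Metric.ball_mem_nhds a hr))] at ht
  obtain ⟨r', hr', hrt⟩ := Metric.mem_nhdsWithin_iff.1 (Filter.inter_mem hst ht')
  set v := Metric.ball a r' ∩ U
  have hv : Convex ℝ v := (convex_ball _ _).inter hconv
  have hav : a ∈ v := ⟨Metric.mem_ball_self hr', ha⟩
  have hT : ∀ b ∈ v, |f b - f a - f' a (b - a)| ≤ K * ‖b - a‖ ^ 2 := by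
    intro b hb
    have hseg : segment ℝ a b ⊆ v := hv.segment_subset hav hb
    have := (convex_segment (𝕜 := ℝ) a b).norm_image_sub_le_of_norm_hasFDerivWithin_le'
      (f := f) (f' := f') (φ := f' a) (C := K * ‖b - a‖)
      (fun z hz => ((hf' z (hru (hrt (hseg hz)).1)).mono
        fun w hw => hru (hrt (hseg hw)).1)) (fun z hz => ?_)
      (left_mem_segment ℝ a b) (right_mem_segment ℝ a b)
    · rw [Real.norm_eq_abs] at this
      rw [pow_two, ← mul_assoc]; exact this
    · have h1 := hK.dist_le_mul z (hrt (hseg hz)).2 a (hrt hav).2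
      rw [dist_eq_norm, dist_eq_norm] at h1
      refine h1.trans ?_
      gcongr
      obtain ⟨t, ht, rfl⟩ := (segment_eq_image' ℝ a b ▸ hz)
      simp only [add_sub_cancel_left, norm_smul, Real.norm_eq_abs, abs_of_nonneg ht.1]
      exact mul_le_of_le_one_left (norm_nonneg _) ht.2
  refine ⟨2 * K, by positivity, ?_⟩
  have hvn : v ∈ 𝓝[U] a := Filter.inter_mem (mem_nhdsWithin_of_mem_nhds
    (Metric.ball_mem_nhds a hr')) self_mem_nhdsWithin
  filter_upwards [hvn] with b hb
  have hm : midpoint ℝ a b ∈ v := hv.midpoint_mem hav hb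
  refine ⟨hm.2, ?_⟩
  have h1 := abs_le.1 (hT b hb)
  have h2 := abs_le.1 (hT _ hm)
  have e1 : midpoint ℝ a b - a = (1 / 2 : ℝ) • (b - a) := by
    rw [midpoint_sub_left]; simp
  have e2 : ‖midpoint ℝ a b - a‖ ^ 2 = ‖b - a‖ ^ 2 / 4 := by
    rw [e1, norm_smul]; norm_num; ring
  have e3 : f' a (midpoint ℝ a b - a) = f' a (b - a) / 2 := by
    rw [e1, map_smul]; simp; ring
  rw [e2, e3] at h2
  have : 0 ≤ (K : ℝ) * ‖b - a‖ ^ 2 := by positivity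
  nlinarith [h1.1, h1.2, h2.1, h2.2]

lemma ConditionA.locallyHellinger {Θ : Set (Param k)}
    {W : Param k → Channel d μ} (h : ConditionA Θ W) :
    LocallyHellinger Θ W := by
  obtain ⟨W₀, g, hg, hW, U, hΘU, hU, hφ⟩ := h
  intro θ hθ x
  have hmgf : ∀ θ' ∈ U, mgfAt W₀ g x θ' = ENNReal.ofReal (Real.exp (potential W₀ g x θ')) := by
    intro θ' hθ'
    have hne : mgfAt W₀ g x θ' ≠ 0 := by
      intro h0
      have hm := W₀.measurable_density x
      have hgm := hg x
      rw [mgfAt, lintegral_eq_zero_iff (by fun_prop)] at h0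
      have h1 : (fun y => (W₀.density x y : ℝ≥0∞)) =ᵐ[μ] 0 := by
        filter_upwards [h0] with y hy
        simpa [(Real.exp_pos _).not_ge] using hy
      have := W₀.lintegral_density x
      rw [lintegral_congr_ae h1] at this
      simp at this
    rw [potential, Real.exp_log (ENNReal.toReal_pos hne ((hφ x).1 θ' hθ').ne),
      ENNReal.ofReal_toReal ((hφ x).1 θ' hθ').ne]
  obtain ⟨c, hc, hev⟩ := exists_second_difference_bound hU (hφ x).2 (hΘU hθ)
  refine ⟨c, hc, ?_⟩
  filter_upwards [nhdsWithin_mono _ hΘU hev, self_mem_nhdsWithin] with θ' ⟨hm, hle⟩ hθ'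
  set m := midpoint ℝ θ θ'
  set φ := potential W₀ g x
  -- the affinity is the moment generating function at the midpoint, up to the normalisations
  have haff : affinity μ ((W θ).density x) ((W θ').density x) =
      ENNReal.ofReal (Real.exp (φ m - (φ θ + φ θ') / 2)) := by
    have h1 : affinity μ ((W θ).density x) ((W θ').density x) =
        ∫⁻ y, ENNReal.ofReal (Real.exp (-((φ θ + φ θ') / 2))) * ((W₀.density x y : ℝ≥0∞) *
          ENNReal.ofReal (Real.exp (∑ j, m ⟨x, j⟩ * g x j y))) ∂μ := by
      refine lintegral_congr_ae ?_
      filter_upwards [hW θ hθ x, hW θ' hθ' x] with y hy hy'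
      have hm' : ∑ j, m ⟨x, j⟩ * g x j y =
          (∑ j, θ ⟨x, j⟩ * g x j y + ∑ j, θ' ⟨x, j⟩ * g x j y) / 2 := by
        rw [← Finset.sum_add_distrib, Finset.sum_div]
        refine Finset.sum_congr rfl fun j _ => ?_
        have : m ⟨x, j⟩ = (θ ⟨x, j⟩ + θ' ⟨x, j⟩) / 2 := by
          simp [m, midpoint_eq_smul_add]; ring
        rw [this]; ring
      rw [← ENNReal.ofReal_coe_nnreal (p := W₀.density x y),
        ← ENNReal.ofReal_coe_nnreal (p := NNReal.sqrt _), ← ENNReal.ofReal_mul NNReal.zero_le_coe,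
        ← ENNReal.ofReal_mul (Real.exp_pos _).le]
      congr 1
      rw [Real.coe_sqrt, NNReal.coe_mul, hy, hy', Real.sqrt_eq_iff_mul_self_eq
        (by positivity) (by positivity), hm']
      set w : ℝ := ((W₀.density x y : ℝ≥0) : ℝ)
      set S := ∑ j, θ ⟨x, j⟩ * g x j y
      set S' := ∑ j, θ' ⟨x, j⟩ * g x j y
      have : ∀ a b c e : ℝ, a + a + (b + b) = c + e → (Real.exp a * (w * Real.exp b)) *
          (Real.exp a * (w * Real.exp b)) = w * Real.exp c * (w * Real.exp e) := by
        intro a b c e habc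
        have := congrArg Real.exp habc
        simp only [Real.exp_add] at this
        linear_combination w ^ 2 * this
      have hsum : -((φ θ + φ θ') / 2) + -((φ θ + φ θ') / 2) + ((S + S') / 2 + (S + S') / 2) =
          S - φ θ + (S' - φ θ') := by ring
      exact (this _ _ _ _ hsum).symm
    have hm₀ := W₀.measurable_density x
    have hgm := hg x
    rw [h1, lintegral_const_mul _ (by fun_prop)]
    have := hmgf m hm
    rw [mgfAt] at this
    rw [this, ← ENNReal.ofReal_mul (Real.exp_pos _).le, ← Real.exp_add]
    congr 2
    ring
  rw [haff]
  refine ENNReal.ofReal_le_ofReal ?_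
  have := Real.add_one_le_exp (φ m - (φ θ + φ θ') / 2)
  linarith

lemma locallyHellinger_of_condition {Θ : Set (Param k)} {W : Param k → Channel d μ}
    (hW : ConditionA Θ W ∨ ConditionB Θ W ∨ ConditionC Θ W) : LocallyHellinger Θ W := by
  rcases hW with h | h | h
  · exact h.locallyHellinger
  · exact h.2.locallyHellinger fun θ hθ => ⟨Θ, rfl, hθ⟩
  · exact h.2.locallyHellinger fun θ hθ =>
      ⟨{θ}, ⟨isCompact_singleton, Set.singleton_subset_iff.2 hθ⟩, rfl⟩

/-! ### The information density and its moments -/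

lemma pmf_sum_eq_one (P : PMF (Fin d)) : ∑ x, P x = 1 := by
  rw [← tsum_fintype (L := .unconditional _)]; exact P.tsum_coe

namespace Channel

lemma measurable_mixDensity (W : Channel d μ) (P : PMF (Fin d)) : Measurable (W.mixDensity P) := by
  have := W.measurable_density
  unfold mixDensity
  fun_prop

lemma coe_mixDensity (W : Channel d μ) (P : PMF (Fin d)) (y : 𝒴) :
    (W.mixDensity P y : ℝ≥0∞) = ∑ x, P x * W.density x y := by
  simp only [mixDensity, ENNReal.ofNNReal_finsetSum, ENNReal.coe_mul]
  refine Finset.sum_congr rfl fun x _ => ?_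
  rw [ENNReal.coe_toNNReal (P.apply_ne_top x)]

lemma lintegral_mixDensity (W : Channel d μ) (P : PMF (Fin d)) :
    ∫⁻ y, (W.mixDensity P y : ℝ≥0∞) ∂μ = 1 := by
  have := W.measurable_density
  simp_rw [coe_mixDensity]
  rw [lintegral_finsetSum _ (by fun_prop)]
  calc ∑ x, ∫⁻ y, P x * W.density x y ∂μ = ∑ x, P x := by
        refine Finset.sum_congr rfl fun x _ => ?_
        rw [lintegral_const_mul _ (by fun_prop), W.lintegral_density, mul_one]
    _ = 1 := pmf_sum_eq_one P

instance (W : Channel d μ) (P : PMF (Fin d)) : IsProbabilityMeasure (W.mixLaw P) :=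
  ⟨by rw [mixLaw, withDensity_apply _ MeasurableSet.univ, Measure.restrict_univ,
    W.lintegral_mixDensity]⟩

lemma mixDensity_pos (W : Channel d μ) (P : PMF (Fin d)) {x : Fin d} {y : 𝒴} (hx : P x ≠ 0)
    (hy : W.density x y ≠ 0) : 0 < W.mixDensity P y := by
  have h1 : 0 < (P x).toNNReal * W.density x y :=
    mul_pos (ENNReal.toNNReal_pos hx (P.apply_ne_top x)) (pos_iff_ne_zero.2 hy)
  exact h1.trans_le (Finset.single_le_sum (f := fun x => (P x).toNNReal * W.density x y)
    (fun _ _ => zero_le) (Finset.mem_univ x))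

/-- The joint law of an input of distribution `P` and its output, one letter. -/
def joint (W : Channel d μ) (P : PMF (Fin d)) : Measure (Fin d × 𝒴) := jointLaw P W.law

instance (W : Channel d μ) (P : PMF (Fin d)) : IsProbabilityMeasure (W.joint P) :=
  isProbabilityMeasure_jointLaw (pmf_sum_eq_one P)

instance (W : Channel d μ) {n : ℕ} (x : Fin n → Fin d) : IsProbabilityMeasure (W.nLaw x) := by
  unfold nLaw; infer_instance

lemma measurable_density_uncurry (W : Channel d μ) :
    Measurable fun z : Fin d × 𝒴 => W.density z.1 z.2 :=
  measurable_from_prod_countable_right fun x => W.measurable_density x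

lemma ae_joint (W : Channel d μ) (P : PMF (Fin d)) :
    ∀ᵐ z ∂(W.joint P), W.density z.1 z.2 ≠ 0 ∧ P z.1 ≠ 0 := by
  have hm := W.measurable_density_uncurry
  have hS : MeasurableSet {z : Fin d × 𝒴 | ¬ (W.density z.1 z.2 ≠ 0 ∧ P z.1 ≠ 0)} := by
    refine MeasurableSet.compl (MeasurableSet.inter ?_ ?_)
    · exact (hm (measurableSet_singleton 0)).compl
    · exact measurable_fst (MeasurableSet.of_discrete (s := {x | P x ≠ 0}))
  rw [ae_iff, joint, jointLaw_apply hS]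
  refine Finset.sum_eq_zero fun x _ => ?_
  rcases eq_or_ne (P x) 0 with hx | hx
  · simp [hx]
  · have : Prod.mk x ⁻¹' {z : Fin d × 𝒴 | ¬ (W.density z.1 z.2 ≠ 0 ∧ P z.1 ≠ 0)} =
        {y | W.density x y = 0} := by ext y; simp [hx]
    have hz : MeasurableSet {y | W.density x y = 0} :=
      W.measurable_density x (measurableSet_singleton 0)
    rw [this, law_apply W x hz, setLIntegral_congr_fun (g := fun _ => 0) hz
      (fun y hy => by simpa using hy)]
    simp

lemma ae_joint_mix (W : Channel d μ) (P : PMF (Fin d)) :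
    ∀ᵐ z ∂(W.joint P), 0 < W.density z.1 z.2 ∧ 0 < W.mixDensity P z.2 := by
  filter_upwards [W.ae_joint P] with z hz
  exact ⟨pos_iff_ne_zero.2 hz.1, W.mixDensity_pos P hz.2 hz.1⟩

/-- The information density `log (W_x(y) / (W · P)(y))`; off the support of the joint law the value
is junk. -/
def infoDensity (W : Channel d μ) (P : PMF (Fin d)) (z : Fin d × 𝒴) : ℝ :=
  Real.log ((W.density z.1 z.2 : ℝ) / (W.mixDensity P z.2 : ℝ))

lemma measurable_infoDensity (W : Channel d μ) (P : PMF (Fin d)) :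
    Measurable (W.infoDensity P) := by
  have h1 := W.measurable_density_uncurry
  have h2 := W.measurable_mixDensity P
  unfold infoDensity
  fun_prop

/-- The reference measure need not be σ-finite, so Radon-Nikodym derivatives are taken with respect
to the mixture, which dominates `W_x` as soon as `P x ≠ 0`. -/
lemma law_eq_withDensity_mixLaw (W : Channel d μ) (P : PMF (Fin d)) {x : Fin d} (hx : P x ≠ 0) :
    W.law x = (W.mixLaw P).withDensity
      fun y => ((W.density x y / W.mixDensity P y : ℝ≥0) : ℝ≥0∞) := by
  have h1 := W.measurable_density x
  have h2 := W.measurable_mixDensity P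
  rw [mixLaw, ← withDensity_mul _ (by fun_prop) (by fun_prop), law]
  congr 1
  ext y
  rw [Pi.mul_apply, ← ENNReal.coe_mul]
  congr 1
  rcases eq_or_ne (W.density x y) 0 with hy | hy
  · simp [hy]
  · exact (mul_div_cancel₀ _ (W.mixDensity_pos P hx hy).ne').symm

lemma integral_log_density_div (W : Channel d μ) (P : PMF (Fin d)) {x : Fin d} (hx : P x ≠ 0) :
    ∫ y, W.infoDensity P (x, y) ∂(W.law x) =
      (InformationTheory.klDiv (W.law x) (W.mixLaw P)).toReal := by
  have h1 := W.measurable_density x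
  have h2 := W.measurable_mixDensity P
  have hlaw := W.law_eq_withDensity_mixLaw P hx
  have hac : W.law x ≪ W.mixLaw P := by
    rw [hlaw]; exact withDensity_absolutelyContinuous _ _
  rw [InformationTheory.toReal_klDiv_of_measure_eq hac (by simp)]
  refine integral_congr_ae ?_
  have : (W.law x).rnDeriv (W.mixLaw P) =ᵐ[W.mixLaw P]
      fun y => ((W.density x y / W.mixDensity P y : ℝ≥0) : ℝ≥0∞) := by
    rw [hlaw]; exact Measure.rnDeriv_withDensity _ (by fun_prop)
  filter_upwards [hac.ae_le this] with y hy
  simp [llr, hy, infoDensity]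

section moments

variable {W : Channel d μ} {P : PMF (Fin d)}

lemma infoVariance_eq_lintegral (W : Channel d μ) (P : PMF (Fin d)) :
    infoVariance P W = ∫⁻ z, ENNReal.ofReal
      ((W.infoDensity P z - (mutualInfo P W).toReal) ^ 2) ∂(W.joint P) := by
  have := W.measurable_infoDensity P
  rw [joint, lintegral_jointLaw (by fun_prop)]
  rfl

lemma memLp_infoDensity (hV : infoVariance P W < ∞) :
    MemLp (W.infoDensity P) 2 (W.joint P) := by
  have hm := W.measurable_infoDensity P
  have h : MemLp (fun z => W.infoDensity P z - (mutualInfo P W).toReal) 2 (W.joint P) := by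
    rw [memLp_two_iff_integrable_sq (by fun_prop)]
    refine ⟨by fun_prop, ?_⟩
    rw [hasFiniteIntegral_iff_ofReal (ae_of_all _ fun _ => sq_nonneg _),
      ← infoVariance_eq_lintegral]
    exact hV
  convert! h.add (memLp_const (mutualInfo P W).toReal) using 1
  ext z; simp

lemma integral_infoDensity (hI : mutualInfo P W < ∞) (hV : infoVariance P W < ∞) :
    ∫ z, W.infoDensity P z ∂(W.joint P) = (mutualInfo P W).toReal := by
  have hm := W.measurable_infoDensity P
  have hint : Integrable (W.infoDensity P) (W.joint P) :=
    (memLp_infoDensity hV).integrable one_le_two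
  rw [joint, jointLaw] at hint ⊢
  rw [integral_finsetSum_measure fun x hx => hint.mono_measure
    (Finset.single_le_sum (f := fun x => P x • (W.law x).map (Prod.mk x))
      (fun _ _ => Measure.zero_le _) hx)]
  have hsum : ∀ x ∈ Finset.univ, P x * InformationTheory.klDiv (W.law x) (W.mixLaw P) ≠ ∞ :=
    fun x hx => (ENNReal.sum_lt_top.1 hI x hx).ne
  rw [mutualInfo, ENNReal.toReal_sum hsum]
  refine Finset.sum_congr rfl fun x _ => ?_
  rw [integral_smul_measure, ENNReal.toReal_mul, smul_eq_mul,
    integral_map measurable_prodMk_left.aemeasurable hm.aestronglyMeasurable]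
  rcases eq_or_ne (P x) 0 with hx | hx
  · simp [hx]
  · rw [W.integral_log_density_div P hx]

lemma variance_infoDensity (hI : mutualInfo P W < ∞) (hV : infoVariance P W < ∞) :
    ProbabilityTheory.variance (W.infoDensity P) (W.joint P) = (infoVariance P W).toReal := by
  have hm := W.measurable_infoDensity P
  rw [ProbabilityTheory.variance_eq_integral hm.aemeasurable, integral_infoDensity hI hV,
    integral_eq_lintegral_of_nonneg_ae (ae_of_all _ fun _ => sq_nonneg _) (by fun_prop),
    infoVariance_eq_lintegral]

end moments

end Channel

lemma measureReal_gaussianReal_Iic (c : ℝ) :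
    (ProbabilityTheory.gaussianReal 0 1).real (Set.Iic c) =
      ∫ x in Set.Iic c, 1 / Real.sqrt (2 * Real.pi) * Real.exp (-(x ^ 2) / 2) := by
  rw [measureReal_def, ProbabilityTheory.gaussianReal_apply_eq_integral _ one_ne_zero,
    ENNReal.toReal_ofReal (integral_nonneg fun x => ProbabilityTheory.gaussianPDFReal_nonneg _ _ _)]
  simp [ProbabilityTheory.gaussianPDFReal]

/-! ### The mixture decoder -/

section score
variable {ι : Type*} (s : Finset ι) (W : ι → Channel d μ) (P : PMF (Fin d)) {n : ℕ}

/-- `∑ j ∈ s, ∏ t, W_{j, a_t}(y_t)`: up to the factor `1 / |s|`, the output density of the uniform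
mixture of the channels in `s` for the input word `a`. -/
def blockScore (a : Fin n → Fin d) (y : Fin n → 𝒴) : ℝ≥0 :=
  ∑ j ∈ s, ∏ t, (W j).density (a t) (y t)

/-- `∑ j ∈ s, ∏ t, (W_j · P)(y_t)`: up to the factor `1 / |s|`, the output density of the uniform
mixture of the channels in `s` for independent inputs of distribution `P`. -/
def outputScore (y : Fin n → 𝒴) : ℝ≥0 :=
  ∑ j ∈ s, ∏ t, (W j).mixDensity P (y t)

lemma measurable_blockScore (a : Fin n → Fin d) : Measurable (blockScore s W a) := by
  have := fun j x => (W j).measurable_density x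
  unfold blockScore
  fun_prop

lemma measurable_outputScore : Measurable (outputScore s W P (n := n)) := by
  have := fun j => (W j).measurable_mixDensity P
  unfold outputScore
  fun_prop

lemma sum_mul_blockScore (y : Fin n → 𝒴) :
    ∑ a : Fin n → Fin d, (∏ t, (P (a t)).toNNReal) * blockScore s W a y =
      outputScore s W P y := by
  simp only [blockScore, outputScore, Channel.mixDensity, Finset.prod_univ_sum,
    Fintype.piFinset_univ, Finset.mul_sum, Finset.prod_mul_distrib]
  exact Finset.sum_comm

/-- The outputs accepted for the codeword `a`. The inequality is between products, not ratios, and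
strict, so an output of score zero is accepted for no codeword of positive probability. -/
def decisionSet (T : ℝ≥0) (a : Fin n → Fin d) : Set (Fin n → 𝒴) :=
  {y | T * outputScore s W P y < blockScore s W a y}

lemma measurableSet_decisionSet (T : ℝ≥0) (a : Fin n → Fin d) :
    MeasurableSet (decisionSet s W P T a) :=
  measurableSet_lt ((measurable_outputScore s W P).const_mul T) (measurable_blockScore s W a)

/-- Markov's inequality over the codeword, at a fixed output `y`. -/
lemma sum_indicator_decisionSet_le {T : ℝ≥0} (hT : 0 < T) (y : Fin n → 𝒴) :
    ∑ a : Fin n → Fin d, (∏ t, P (a t)) * (decisionSet s W P T a).indicator 1 y ≤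
      ENNReal.ofReal (1 / T) := by
  classical
  have h1 : ∀ a : Fin n → Fin d, (∏ t, P (a t)) * (decisionSet s W P T a).indicator 1 y =
      (((∏ t, (P (a t)).toNNReal) *
        (if y ∈ decisionSet s W P T a then 1 else 0) : ℝ≥0) : ℝ≥0∞) := by
    intro a
    rw [ENNReal.coe_mul, ENNReal.ofNNReal_finsetProd]
    congr 1
    · exact Finset.prod_congr rfl fun t _ => (ENNReal.coe_toNNReal (P.apply_ne_top _)).symm
    · by_cases h : y ∈ decisionSet s W P T a <;> simp [h]
  simp_rw [h1]
  rw [← ENNReal.ofNNReal_finsetSum, ENNReal.ofReal, ENNReal.coe_le_coe,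
    ← NNReal.coe_le_coe, Real.coe_toNNReal _ (by positivity), one_div, ← NNReal.coe_inv,
    NNReal.coe_le_coe]
  have hsum := sum_mul_blockScore s W P y
  rcases eq_or_ne (outputScore s W P y) 0 with h0 | h0
  · rw [h0, Finset.sum_eq_zero_iff] at hsum
    rw [Finset.sum_eq_zero]
    · exact zero_le
    intro a ha
    by_cases h : y ∈ decisionSet s W P T a
    · have h2 : T * outputScore s W P y < blockScore s W a y := h
      rw [h0, mul_zero] at h2
      have := (mul_eq_zero.1 (hsum a ha)).resolve_right h2.ne'
      simp [this]
    · simp [h]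
  · have hpos : 0 < T * outputScore s W P y := mul_pos hT (pos_iff_ne_zero.2 h0)
    rw [← one_div, le_div_iff₀ hT]
    refine le_of_mul_le_mul_right ?_ (pos_iff_ne_zero.2 h0)
    rw [one_mul, mul_assoc, Finset.sum_mul]
    conv_rhs => rw [← hsum]
    refine Finset.sum_le_sum fun a _ => ?_
    rw [mul_assoc]
    gcongr
    split_ifs with h
    · rw [one_mul]; exact (show T * outputScore s W P y < blockScore s W a y from h).le
    · simp

end score

namespace Channel

/-- The total variation distance of `W_x` and `W'_x` is at most `ε` for every input `x`. -/
def IsClose (W W' : Channel d μ) (ε : ℝ≥0) : Prop :=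
  ∀ x E, MeasurableSet E → W.law x E ≤ W'.law x E + ε ∧ W'.law x E ≤ W.law x E + ε

variable {W W' : Channel d μ} {ε : ℝ≥0} {P : PMF (Fin d)} {n : ℕ}

lemma IsClose.symm (h : W.IsClose W' ε) : W'.IsClose W ε := fun x E hE => (h x E hE).symm

lemma IsClose.nLaw_le (h : W.IsClose W' ε) (a : Fin n → Fin d) {E : Set (Fin n → 𝒴)}
    (hE : MeasurableSet E) : W.nLaw a E ≤ W'.nLaw a E + n * ε :=
  measure_pi_le_add _ _ _ (fun t E hE => (h (a t) E hE).1) E hE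

/-- If `W'` is close to `W`, its density is rarely smaller than that of `W` by more than the factor
`n / (n + 1)`, whose `n`-th power is at least `e⁻¹`. -/
lemma IsClose.joint_lt_le (h : W.IsClose W' ε) :
    W.joint P {z | (n + 1) * W'.density z.1 z.2 < n * W.density z.1 z.2} ≤ (n + 1) * ε := by
  have hm := W.measurable_density_uncurry
  have hm' := W'.measurable_density_uncurry
  have hS : MeasurableSet
      {z : Fin d × 𝒴 | (n + 1) * W'.density z.1 z.2 < n * W.density z.1 z.2} :=
    measurableSet_lt (by fun_prop) (by fun_prop)
  rw [joint, jointLaw_apply hS]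
  have key : ∀ x, W.law x (Prod.mk x ⁻¹'
      {z : Fin d × 𝒴 | (n + 1) * W'.density z.1 z.2 < n * W.density z.1 z.2}) ≤ (n + 1) * ε := by
    intro x
    set E := Prod.mk x ⁻¹' {z : Fin d × 𝒴 | (n + 1) * W'.density z.1 z.2 < n * W.density z.1 z.2}
    have hE : MeasurableSet E := measurable_prodMk_left hS
    have h1 := (h x E hE).1
    have hmx := W.measurable_density x
    have hmx' := W'.measurable_density x
    have h2 : (n + 1) * W'.law x E ≤ n * W.law x E := by
      rw [law_apply _ _ hE, law_apply _ _ hE, ← lintegral_const_mul _ (by fun_prop),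
        ← lintegral_const_mul _ (by fun_prop)]
      refine setLIntegral_mono (by fun_prop) fun y hy => ?_
      have : (n + 1) * W'.density x y < n * W.density x y := hy
      exact_mod_cast this.le
    have f1 : W.law x E ≠ ∞ := measure_ne_top _ _
    have f2 : W'.law x E ≠ ∞ := measure_ne_top _ _
    generalize W.law x E = w at *
    generalize W'.law x E = w' at *
    lift w to ℝ≥0 using f1
    lift w' to ℝ≥0 using f2
    norm_cast at h1 h2 ⊢
    rw [← NNReal.coe_le_coe] at h1 h2 ⊢
    push_cast at h1 h2 ⊢
    nlinarith
  calc ∑ x, P x * _ ≤ ∑ x, P x * ((n + 1) * ε : ℝ≥0∞) := by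
        gcongr with x; exact key x
    _ = (n + 1) * ε := by rw [← Finset.sum_mul, pmf_sum_eq_one, one_mul]

lemma lintegral_mixDensity_ratio_le (W W' : Channel d μ) (P : PMF (Fin d)) :
    ∫⁻ z, ((W'.mixDensity P z.2 / W.mixDensity P z.2 : ℝ≥0) : ℝ≥0∞) ∂(W.joint P) ≤ 1 := by
  have hm := W.measurable_density
  have hq := W.measurable_mixDensity P
  have hq' := W'.measurable_mixDensity P
  rw [joint, lintegral_jointLaw (by fun_prop)]
  have : ∀ x, P x * ∫⁻ y, ((W'.mixDensity P y / W.mixDensity P y : ℝ≥0) : ℝ≥0∞) ∂(W.law x) =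
      ∫⁻ y, P x * W.density x y * ((W'.mixDensity P y / W.mixDensity P y : ℝ≥0) : ℝ≥0∞) ∂μ := by
    intro x
    rw [law, lintegral_withDensity_eq_lintegral_mul _ (by fun_prop) (by fun_prop),
      ← lintegral_const_mul _ (by fun_prop)]
    simp [mul_assoc]
  simp only [this]
  rw [← lintegral_finsetSum _ (by fun_prop)]
  simp_rw [← Finset.sum_mul, ← coe_mixDensity]
  refine (lintegral_mono fun y => ?_).trans (W'.lintegral_mixDensity P).le
  rw [← ENNReal.coe_mul, ENNReal.coe_le_coe]
  rcases eq_or_ne (W.mixDensity P y) 0 with h | h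
  · simp [h]
  · exact (mul_div_cancel₀ _ h).le

/-- Markov's inequality for the ratio of `outputScore` to the true output density, whose mean is at
most the number of summands. -/
lemma measure_outputScore_gt_le {ι : Type*} (s : Finset ι) (V : ι → Channel d μ)
    (W : Channel d μ) (P : PMF (Fin d)) {c : ℝ≥0} (hc : 0 < c) :
    Measure.pi (fun _ : Fin n => W.joint P)
      {z | c * ∏ t, W.mixDensity P (z t).2 < outputScore s V P fun t => (z t).2} ≤
        s.card / c := by
  have hq := W.measurable_mixDensity P
  have hq' := fun j => (V j).measurable_mixDensity P
  set J := Measure.pi (fun _ : Fin n => W.joint P)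
  let r : (Fin n → Fin d × 𝒴) → ℝ≥0∞ := fun z =>
    ∑ j ∈ s, ∏ t, (((V j).mixDensity P (z t).2 / W.mixDensity P (z t).2 : ℝ≥0) : ℝ≥0∞)
  have hr : ∫⁻ z, r z ∂J ≤ s.card := by
    simp only [r]
    rw [lintegral_finsetSum _ fun j _ => by fun_prop]
    calc _ ≤ ∑ j ∈ s, (1 : ℝ≥0∞) := by
          refine Finset.sum_le_sum fun j _ => ?_
          rw [lintegral_pi_prod (W.joint P) (fun z =>
            (((V j).mixDensity P z.2 / W.mixDensity P z.2 : ℝ≥0) : ℝ≥0∞)) (by fun_prop)]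
          exact pow_le_one' (lintegral_mixDensity_ratio_le W (V j) P) n
      _ = s.card := by simp
  have hae : ∀ᵐ z ∂J, ∀ t, 0 < W.mixDensity P (z t).2 := by
    refine ae_all_iff.2 fun t => ?_
    have := (measurePreserving_eval (fun _ : Fin n => W.joint P) t).quasiMeasurePreserving.ae
      (W.ae_joint_mix P)
    exact this.mono fun z hz => hz.2
  have hsub : ∀ᵐ z ∂J, z ∈ {z : Fin n → Fin d × 𝒴 | c * ∏ t, W.mixDensity P (z t).2 <
      outputScore s V P fun t => (z t).2} → z ∈ {z | (c : ℝ≥0∞) ≤ r z} := by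
    filter_upwards [hae] with z hz hlt
    have hlt' : c * ∏ t, W.mixDensity P (z t).2 < ∑ j ∈ s, ∏ t, (V j).mixDensity P (z t).2 := hlt
    have hpos : 0 < ∏ t, W.mixDensity P (z t).2 := Finset.prod_pos fun t _ => hz t
    rw [← lt_div_iff₀ hpos, Finset.sum_div] at hlt'
    show (c : ℝ≥0∞) ≤ r z
    simp only [r, ← ENNReal.ofNNReal_finsetProd, ← ENNReal.ofNNReal_finsetSum, ENNReal.coe_le_coe]
    refine hlt'.le.trans (le_of_eq ?_)
    simp [Finset.prod_div_distrib]
  refine (measure_mono_ae hsub).trans ?_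
  refine (meas_ge_le_lintegral_div (by fun_prop) (by simpa using hc.ne') (by simp)).trans ?_
  gcongr

/-- If `V j` is close to `W`, then up to a small probability the sent codeword is rejected only when
the information density of `W` is small. The channel is changed from `V j` to `W` in the law of the
output, and from `W` to `V j` in the score. -/
lemma IsClose.sum_nLaw_compl_decisionSet_le {ι : Type*} {s : Finset ι} {V : ι → Channel d μ}
    {j : ι} (hj : j ∈ s) (h : W.IsClose (V j) ε) (hn : 0 < n) {T : ℝ≥0} (hT : 0 < T) :
    ∑ a : Fin n → Fin d, (∏ t, P (a t)) * (V j).nLaw a (decisionSet s V P T a)ᶜ ≤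
      Measure.pi (fun _ : Fin n => W.joint P)
        {z | ∑ t, W.infoDensity P (z t) ≤ Real.log T + Real.log (s.card * n) + 1} +
      (n * ((n + 1) * ε) + 1 / n + n * ε) := by
  set J := Measure.pi (fun _ : Fin n => W.joint P)
  have hm := W.measurable_density_uncurry
  have hm' := (V j).measurable_density_uncurry
  have hbs : Measurable fun z : Fin n → Fin d × 𝒴 =>
      blockScore s V (fun t => (z t).1) fun t => (z t).2 := by
    have := fun j => (V j).measurable_density_uncurry
    unfold blockScore
    exact Finset.measurable_fun_sum _ fun j _ => Finset.measurable_fun_prod _ fun t _ =>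
      (this j).comp (measurable_pi_apply t)
  have hos : Measurable fun z : Fin n → Fin d × 𝒴 => outputScore s V P fun t => (z t).2 :=
    (measurable_outputScore s V P).comp (by fun_prop)
  set Bad : Set (Fin n → Fin d × 𝒴) := {z | blockScore s V (fun t => (z t).1) (fun t => (z t).2) ≤
    T * outputScore s V P fun t => (z t).2} with hBad
  have hBadm : MeasurableSet Bad := measurableSet_le hbs (hos.const_mul T)
  have hstep : ∑ a : Fin n → Fin d, (∏ t, P (a t)) * (V j).nLaw a (decisionSet s V P T a)ᶜ ≤
      J Bad + n * ε := by
    calc _ ≤ ∑ a : Fin n → Fin d, (∏ t, P (a t)) *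
          (W.nLaw a (decisionSet s V P T a)ᶜ + n * ε) := by
          gcongr with a
          exact h.symm.nLaw_le a (measurableSet_decisionSet s V P T a).compl
      _ = J Bad + n * ε := by
          simp only [mul_add]
          rw [Finset.sum_add_distrib, ← Finset.sum_mul]
          congr 1
          · rw [show J Bad = _ from pi_jointLaw_apply (pmf_sum_eq_one P) hBadm]
            refine Finset.sum_congr rfl fun a _ => ?_
            congr 2
            ext y
            simp [hBad, decisionSet]
          · have : ∑ a : Fin n → Fin d, ∏ t, P (a t) = 1 := by
              rw [← Fintype.piFinset_univ, ← Finset.prod_univ_sum]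
              simp [pmf_sum_eq_one]
            rw [this, one_mul]
  refine hstep.trans ?_
  rw [← add_assoc]
  gcongr
  set c : ℝ≥0 := s.card * n
  have hcard : 0 < s.card := Finset.card_pos.2 ⟨j, hj⟩
  have hc : 0 < c := by positivity
  set A := {z : Fin n → Fin d × 𝒴 |
    ∑ t, W.infoDensity P (z t) ≤ Real.log T + Real.log (s.card * n) + 1}
  set B₀ := {z : Fin d × 𝒴 | (n + 1) * (V j).density z.1 z.2 < n * W.density z.1 z.2}
  set B := ⋃ t : Fin n, (Function.eval t : (Fin n → Fin d × 𝒴) → _) ⁻¹' B₀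
  set C := {z : Fin n → Fin d × 𝒴 |
    c * ∏ t, W.mixDensity P (z t).2 < outputScore s V P fun t => (z t).2}
  have hB : J B ≤ n * ((n + 1) * ε) := by
    refine (measure_iUnion_le _).trans ?_
    rw [tsum_fintype (L := .unconditional _)]
    have hB₀ : MeasurableSet B₀ := measurableSet_lt (by fun_prop) (by fun_prop)
    calc ∑ t : Fin n, J ((Function.eval t) ⁻¹' B₀) ≤ ∑ t : Fin n, ((n + 1) * ε : ℝ≥0∞) := by
          gcongr with t
          rw [(measurePreserving_eval (fun _ : Fin n => W.joint P) t).measure_preimage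
            hB₀.nullMeasurableSet]
          exact h.joint_lt_le
      _ = _ := by simp
  have hC : J C ≤ 1 / n := by
    refine (measure_outputScore_gt_le s V W P hc).trans (le_of_eq ?_)
    simp only [c, ENNReal.coe_mul, ENNReal.coe_natCast]
    rw [one_div, ENNReal.div_eq_inv_mul, ENNReal.mul_inv (by simp) (by simp), mul_right_comm,
      ENNReal.inv_mul_cancel (by simpa using hcard.ne') (by simp), one_mul]
  have hae : ∀ᵐ z ∂J, ∀ t, 0 < W.density (z t).1 (z t).2 ∧ 0 < W.mixDensity P (z t).2 := by
    refine ae_all_iff.2 fun t => ?_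
    exact (measurePreserving_eval (fun _ : Fin n => W.joint P) t).quasiMeasurePreserving.ae
      (W.ae_joint_mix P)
  have hsub : ∀ᵐ z ∂J, z ∈ Bad → z ∈ A ∪ B ∪ C := by
    filter_upwards [hae] with z hz hbad
    by_contra hcon
    -- off `B` and `C`: `∏ W ≤ e ∏ V j ≤ e U ≤ e T Q ≤ e T c ∏ (W · P)`
    simp only [Set.mem_union, not_or] at hcon
    obtain ⟨⟨hA, hB'⟩, hC'⟩ := hcon
    apply hA
    simp only [B, Set.mem_iUnion, Set.mem_preimage, Function.eval, not_exists] at hB'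
    have hB2 : ∀ t, (n : ℝ) * W.density (z t).1 (z t).2 ≤
        (n + 1) * (V j).density (z t).1 (z t).2 := fun t => by
      have : n * W.density (z t).1 (z t).2 ≤ (n + 1) * (V j).density (z t).1 (z t).2 :=
        not_lt.1 fun hlt => hB' t hlt
      exact_mod_cast this
    have hC2 : outputScore s V P (fun t => (z t).2) ≤ c * ∏ t, W.mixDensity P (z t).2 :=
      not_lt.1 hC'
    have hbad2 : blockScore s V (fun t => (z t).1) (fun t => (z t).2) ≤
      T * outputScore s V P fun t => (z t).2 := hbad
    have hV : ∏ t, (V j).density (z t).1 (z t).2 ≤ T * (c * ∏ t, W.mixDensity P (z t).2) := by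
      refine le_trans ?_ (hbad2.trans (by gcongr))
      exact Finset.single_le_sum (f := fun j => ∏ t, (V j).density (z t).1 (z t).2)
        (fun _ _ => zero_le) hj
    have hV' : ∏ t, ((V j).density (z t).1 (z t).2 : ℝ) ≤
        T * (c * ∏ t, (W.mixDensity P (z t).2 : ℝ)) := by exact_mod_cast hV
    have hn' : (0 : ℝ) < n := by exact_mod_cast hn
    have hW : ∏ t, (W.density (z t).1 (z t).2 : ℝ) ≤
        Real.exp 1 * ∏ t, ((V j).density (z t).1 (z t).2 : ℝ) := by
      calc ∏ t, (W.density (z t).1 (z t).2 : ℝ)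
          ≤ ∏ t, (Real.exp (1 / n) * (V j).density (z t).1 (z t).2 : ℝ) := by
            refine Finset.prod_le_prod (fun _ _ => NNReal.coe_nonneg _) fun t _ => ?_
            have h1 : (W.density (z t).1 (z t).2 : ℝ) ≤
                (1 / n + 1) * (V j).density (z t).1 (z t).2 := by
              rw [show (1 / (n : ℝ) + 1) = (n + 1) / n by field_simp; ring,
                div_mul_eq_mul_div, le_div_iff₀ hn',
                mul_comm]
              exact hB2 t
            refine h1.trans ?_
            gcongr
            exact Real.add_one_le_exp _
        _ = Real.exp 1 * ∏ t, ((V j).density (z t).1 (z t).2 : ℝ) := by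
            rw [Finset.prod_mul_distrib, Finset.prod_const, ← Real.exp_nat_mul]
            simp [hn'.ne']
    have hq0 : 0 < ∏ t, (W.mixDensity P (z t).2 : ℝ) :=
      Finset.prod_pos fun t _ => by exact_mod_cast (hz t).2
    have hfin : ∏ t, ((W.density (z t).1 (z t).2 : ℝ) / W.mixDensity P (z t).2) ≤
        T * (s.card * n) * Real.exp 1 := by
      rw [Finset.prod_div_distrib, div_le_iff₀ hq0]
      refine hW.trans ?_
      have := mul_le_mul_of_nonneg_left hV' (Real.exp_pos 1).le
      refine this.trans (le_of_eq ?_)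
      simp only [c]; push_cast; ring
    show ∑ t, W.infoDensity P (z t) ≤ _
    simp only [infoDensity]
    rw [← Real.log_prod fun t _ => (div_pos (by exact_mod_cast (hz t).1)
      (by exact_mod_cast (hz t).2)).ne']
    have hT' : (T : ℝ) ≠ 0 := by exact_mod_cast hT.ne'
    have hsn : ((s.card : ℝ) * n) ≠ 0 := by positivity
    rw [← Real.log_mul hT' hsn]
    conv_rhs => rw [← Real.log_exp 1]
    rw [← Real.log_mul (mul_ne_zero hT' hsn) (Real.exp_pos 1).ne']
    exact Real.log_le_log (Finset.prod_pos fun t _ => div_pos (by exact_mod_cast (hz t).1)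
      (by exact_mod_cast (hz t).2)) hfin
  calc J Bad ≤ J (A ∪ B ∪ C) := measure_mono_ae hsub
    _ ≤ J A + J B + J C := (measure_union_le _ _).trans (by gcongr; exact measure_union_le _ _)
    _ ≤ J A + n * ((n + 1) * ε) + 1 / n := by gcongr
    _ = J A + (n * ((n + 1) * ε) + 1 / n) := add_assoc _ _ _

end Channel

lemma errorProb_eq (W : Channel d μ) {n : ℕ} (Φ : Code d 𝒴 n) :
    errorProb W Φ = (1 / (Φ.size : ℝ)) * ∑ i, (W.nLaw (Φ.enc i)).real {y | Φ.dec y ≠ i} := by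
  rw [errorProb]
  congr 1
  refine Finset.sum_congr rfl fun i _ => ?_
  rw [sum_measureReal_preimage_singleton _ fun j _ => Φ.measurable_dec (measurableSet_singleton j)]
  congr 1
  ext y; simp

lemma Channel.IsClose.errorProb_le {W W' : Channel d μ} {ε : ℝ≥0} (h : W.IsClose W' ε) {n : ℕ}
    (Φ : Code d 𝒴 n) : errorProb W Φ ≤ errorProb W' Φ + n * ε := by
  rw [errorProb_eq, errorProb_eq]
  have hi : ∀ i, (W.nLaw (Φ.enc i)).real {y | Φ.dec y ≠ i} ≤
      (W'.nLaw (Φ.enc i)).real {y | Φ.dec y ≠ i} + n * ε := by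
    intro i
    have hE : MeasurableSet {y | Φ.dec y ≠ i} :=
      (Φ.measurable_dec (measurableSet_singleton i)).compl
    have := ENNReal.toReal_mono (by finiteness) (h.nLaw_le (Φ.enc i) hE)
    rw [ENNReal.toReal_add (by finiteness) (by finiteness)] at this
    simpa [measureReal_def] using this
  rcases Nat.eq_zero_or_pos Φ.size with h0 | h0
  · simp [h0]; positivity
  calc _ ≤ (1 / (Φ.size : ℝ)) * ∑ i, ((W'.nLaw (Φ.enc i)).real {y | Φ.dec y ≠ i} + n * ε) := by
        gcongr with i; exact hi i
    _ = _ := by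
        rw [Finset.sum_add_distrib, mul_add]
        congr 1
        simp; field_simp

/-! ### Nets in the parameter space and universal codes -/

/-- Nets for an arbitrary subset of a Euclidean space: one point of `Θ` from each cube of side `n⁻³`
that meets it, in a box of side growing with `n`. -/
lemma exists_polynomial_nets {ι : Type*} [Fintype ι] (Θ : Set (EuclideanSpace ℝ ι)) :
    ∃ N : ℕ → Finset (EuclideanSpace ℝ ι), (∀ n, ∀ θ ∈ N n, θ ∈ Θ) ∧
      (∀ n, (N n).card ≤ (2 * n ^ 4 + 1) ^ Fintype.card ι) ∧
      ∀ θ ∈ Θ, ∀ᶠ n : ℕ in atTop, ∃ θ' ∈ N n, ‖θ' - θ‖ ≤ Fintype.card ι / (n : ℝ) ^ 3 := by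
  classical
  let cell : ℕ → EuclideanSpace ℝ ι → ι → ℤ := fun n θ i => ⌊(n : ℝ) ^ 3 * θ i⌋
  let box : ℕ → Finset (ι → ℤ) := fun n =>
    Fintype.piFinset fun _ => Finset.Icc (-(n : ℤ) ^ 4) ((n : ℤ) ^ 4)
  let pt : ℕ → (ι → ℤ) → EuclideanSpace ℝ ι := fun n z =>
    if h : ∃ θ ∈ Θ, cell n θ = z then h.choose else 0
  have hpt : ∀ n z, (∃ θ ∈ Θ, cell n θ = z) → pt n z ∈ Θ ∧ cell n (pt n z) = z := by
    intro n z h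
    simp only [pt, dif_pos h]
    exact h.choose_spec
  refine ⟨fun n => ((box n).filter fun z => ∃ θ ∈ Θ, cell n θ = z).image (pt n), ?_, ?_, ?_⟩
  · intro n θ hθ
    obtain ⟨z, hz, rfl⟩ := Finset.mem_image.1 hθ
    exact (hpt n z (Finset.mem_filter.1 hz).2).1
  · intro n
    refine Finset.card_image_le.trans ((Finset.card_filter_le _ _).trans (le_of_eq ?_))
    simp only [box, Fintype.card_piFinset, Int.card_Icc, Finset.prod_const, Finset.card_univ]
    congr 1
    have : ((n : ℤ) ^ 4 + 1 - -(n : ℤ) ^ 4) = ((2 * n ^ 4 + 1 : ℕ) : ℤ) := by push_cast; ring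
    rw [this, Int.toNat_natCast]
  · intro θ hθ
    have hev : ∀ᶠ n : ℕ in atTop, ‖θ‖ + 1 ≤ n :=
      tendsto_natCast_atTop_atTop.eventually_ge_atTop _
    filter_upwards [hev, eventually_ge_atTop 1] with n hn hn1
    have hnr : (1 : ℝ) ≤ n := by exact_mod_cast hn1
    have hn3 : (1 : ℝ) ≤ (n : ℝ) ^ 3 := one_le_pow₀ hnr
    have hcell : ∃ θ' ∈ Θ, cell n θ' = cell n θ := ⟨θ, hθ, rfl⟩
    refine ⟨pt n (cell n θ), Finset.mem_image_of_mem _ (Finset.mem_filter.2 ⟨?_, hcell⟩), ?_⟩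
    · refine Fintype.mem_piFinset.2 fun i => Finset.mem_Icc.2 ?_
      have hi : |θ i| ≤ ‖θ‖ := PiLp.norm_apply_le θ i
      have h1 : |(n : ℝ) ^ 3 * θ i| + 1 ≤ (n : ℝ) ^ 4 := by
        rw [abs_mul, abs_of_nonneg (by positivity : (0 : ℝ) ≤ (n : ℝ) ^ 3)]
        calc (n : ℝ) ^ 3 * |θ i| + 1 ≤ (n : ℝ) ^ 3 * ‖θ‖ + (n : ℝ) ^ 3 := by gcongr
          _ = (n : ℝ) ^ 3 * (‖θ‖ + 1) := by ring
          _ ≤ (n : ℝ) ^ 3 * n := by gcongr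
          _ = (n : ℝ) ^ 4 := by ring
      have h2 := abs_le.1 (le_refl |(n : ℝ) ^ 3 * θ i|)
      constructor
      · rw [Int.le_floor]; push_cast; linarith [h2.1]
      · have : (⌊(n : ℝ) ^ 3 * θ i⌋ : ℝ) ≤ (n : ℝ) ^ 4 :=
          (Int.floor_le _).trans (by linarith [h2.2])
        show ⌊(n : ℝ) ^ 3 * θ i⌋ ≤ (n : ℤ) ^ 4
        exact_mod_cast this
    · have hc := (hpt n _ hcell).2
      set θ' := pt n (cell n θ)
      have hco : ∀ i, |(θ' - θ) i| ≤ 1 / (n : ℝ) ^ 3 := by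
        intro i
        have h1 : ⌊(n : ℝ) ^ 3 * θ' i⌋ = ⌊(n : ℝ) ^ 3 * θ i⌋ := congrFun hc i
        have h2 := Int.abs_sub_lt_one_of_floor_eq_floor h1
        rw [← mul_sub, abs_mul, abs_of_nonneg (by positivity : (0 : ℝ) ≤ (n : ℝ) ^ 3)] at h2
        rw [le_div_iff₀ (by positivity), mul_comm]
        exact h2.le
      calc ‖θ' - θ‖ ≤ ∑ i, |(θ' - θ) i| := by
            rw [EuclideanSpace.norm_eq]
            refine Real.sqrt_le_iff.2 ⟨by positivity, ?_⟩
            exact Finset.sum_sq_le_sq_sum_of_nonneg fun i _ => abs_nonneg _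
        _ ≤ ∑ i : ι, 1 / (n : ℝ) ^ 3 := Finset.sum_le_sum fun i _ => hco i
        _ = Fintype.card ι / (n : ℝ) ^ 3 := by simp [div_eq_mul_inv]

lemma affinity_comm (p q : 𝒴 → ℝ≥0) : affinity μ p q = affinity μ q p := by
  simp only [affinity, mul_comm]

lemma LocallyHellinger.exists_nets {Θ : Set (Param k)} {W : Param k → Channel d μ}
    (hW : LocallyHellinger Θ W) :
    ∃ (K : ℕ) (N : ℕ → Finset (Param k)), (∀ n, (N n).card ≤ (2 * n ^ 4 + 1) ^ K) ∧
      ∀ θ ∈ Θ, ∃ C : ℝ≥0, ∀ᶠ n : ℕ in atTop, ∃ θ' ∈ N n,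
        (W θ).IsClose (W θ') (C / (n : ℝ≥0) ^ 3) := by
  obtain ⟨N, hNΘ, hcard, hN⟩ := exists_polynomial_nets Θ
  refine ⟨_, N, hcard, fun θ hθ => ?_⟩
  choose c hc hev using hW θ hθ
  set K := Fintype.card (Σ x : Fin d, Fin (k x))
  have hev' := eventually_all.2 hev
  obtain ⟨r, hr, hball⟩ := Metric.mem_nhdsWithin_iff.1 hev'
  set Csum : ℝ := ∑ x, c x
  have hCsum : 0 ≤ Csum := Finset.sum_nonneg fun x _ => hc x
  refine ⟨((Csum + 2) * (K + 1)).toNNReal, ?_⟩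
  have hlim : Tendsto (fun n : ℕ => ((K : ℝ) + 1) / (n : ℝ) ^ 3) atTop (𝓝 0) :=
    Tendsto.div_atTop tendsto_const_nhds
      ((tendsto_pow_atTop (by norm_num)).comp tendsto_natCast_atTop_atTop)
  filter_upwards [hN θ hθ, hlim.eventually_lt_const hr, eventually_ge_atTop 1]
    with n ⟨θ', hθ', hdist⟩ hlt hn1
  refine ⟨θ', hθ', fun x E hE => ?_⟩
  have hn : (0 : ℝ) < n := by exact_mod_cast hn1
  set s : ℝ := ((K : ℝ) + 1) / (n : ℝ) ^ 3 with hs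
  have hs0 : 0 < s := by positivity
  have hds : ‖θ' - θ‖ ≤ s := hdist.trans (by rw [hs]; gcongr; linarith)
  have haff := hball ⟨mem_ball_iff_norm.2 (hds.trans_lt hlt), hNΘ n θ' hθ'⟩ x
  have hcx : c x ≤ Csum := Finset.single_le_sum (fun x _ => hc x) (Finset.mem_univ x)
  have haff' : ENNReal.ofReal (1 - Csum * s ^ 2) ≤
      affinity μ ((W θ).density x) ((W θ').density x) := by
    refine le_trans (ENNReal.ofReal_le_ofReal ?_) haff
    gcongr
  have hε : ENNReal.ofReal ((Csum + 2) * s) =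
      ((((Csum + 2) * (K + 1)).toNNReal / (n : ℝ≥0) ^ 3 : ℝ≥0) : ℝ≥0∞) := by
    rw [ENNReal.ofReal, ENNReal.coe_inj]
    rw [← NNReal.coe_inj]
    push_cast
    rw [Real.coe_toNNReal _ (by positivity), Real.coe_toNNReal _ (by positivity), hs]
    ring
  rw [← hε]
  exact ⟨law_le_add_of_affinity _ _ x hCsum hs0 haff' hE,
    law_le_add_of_affinity _ _ x hCsum hs0 (by rwa [affinity_comm]) hE⟩

/-- One code for finitely many channels, with the mixture decoder of threshold `T`. -/
lemma exists_code_of_finset {ι : Type*} (s : Finset ι) (V : ι → Channel d μ) (P : PMF (Fin d))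
    {n M : ℕ} (hM : 0 < M) {T : ℝ≥0} (hT : 0 < T) :
    ∃ Φ : Code d 𝒴 n, Φ.size = M ∧ ∀ j ∈ s, errorProb (V j) Φ ≤
      ∑ a : Fin n → Fin d, (∏ t, P (a t)).toReal *
        ((V j).nLaw a).real (decisionSet s V P T a)ᶜ +
      √(s.card * (1 / M + M * (1 / T))) + s.card * (1 / M + M * (1 / T)) := by
  have hp : ∑ a : Fin n → Fin d, ∏ t, P (a t) = 1 := by
    rw [← Fintype.piFinset_univ, ← Finset.prod_univ_sum]
    simp [pmf_sum_eq_one]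
  obtain ⟨c, dec, hdec, h⟩ := exists_code (J := s) (fun a : Fin n → Fin d => ∏ t, P (a t)) hp
    (fun j a => (V j).nLaw a) (decisionSet s V P T) (measurableSet_decisionSet s V P T)
    (τ := 1 / T) (by positivity) (sum_indicator_decisionSet_le s V P hT) hM
  refine ⟨⟨M, c, dec, hdec⟩, rfl, fun j hj => ?_⟩
  rw [errorProb_eq]
  simpa using h ⟨j, hj⟩

lemma errorProb_nonneg (W : Channel d μ) {n : ℕ} (Φ : Code d 𝒴 n) : 0 ≤ errorProb W Φ := by
  rw [errorProb]; positivity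

lemma errorProb_le_of_isClose {ι : Type*} {s : Finset ι} {V : ι → Channel d μ}
    {P : PMF (Fin d)} {n : ℕ} {Φ : Code d 𝒴 n} {T : ℝ≥0} {κ : ℝ}
    {W : Channel d μ} {ε : ℝ≥0} {j : ι} (hj : j ∈ s) (h : W.IsClose (V j) ε) (hn : 0 < n)
    (hT : 0 < T)
    (hΦ : errorProb (V j) Φ ≤ ∑ a : Fin n → Fin d, (∏ t, P (a t)).toReal *
        ((V j).nLaw a).real (decisionSet s V P T a)ᶜ + κ) :
    errorProb W Φ ≤ (Measure.pi fun _ : Fin n => W.joint P).real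
        {z | ∑ t, W.infoDensity P (z t) ≤ Real.log T + Real.log (s.card * n) + 1} +
      (n * ((n + 1) * ε) + 1 / n + 2 * (n * ε)) + κ := by
  have h1 := h.sum_nLaw_compl_decisionSet_le (P := P) hj hn hT
  have hn0 : (n : ℝ≥0∞) ≠ 0 := by exact_mod_cast hn.ne'
  have hne : (n * ((n + 1) * ε) + 1 / n + n * ε : ℝ≥0∞) ≠ ∞ := by
    have : (1 / n : ℝ≥0∞) ≠ ∞ := ENNReal.div_ne_top (by simp) hn0
    finiteness
  have h2 := ENNReal.toReal_mono (ENNReal.add_ne_top.2 ⟨measure_ne_top _ _, hne⟩) h1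
  have hPne : ∀ a : Fin n → Fin d, ∏ t, P (a t) ≠ ∞ := fun a =>
    ENNReal.prod_ne_top fun t _ => P.apply_ne_top _
  rw [ENNReal.toReal_add (measure_ne_top _ _) hne, ENNReal.toReal_sum
    fun a _ => ENNReal.mul_ne_top (hPne a) (measure_ne_top _ _)] at h2
  have h3 : (n * ((n + 1) * ε) + 1 / n + n * ε : ℝ≥0∞).toReal =
      (n * ((n + 1) * ε) + 1 / n + n * ε : ℝ) := by
    rw [ENNReal.toReal_add (by have : (1 / n : ℝ≥0∞) ≠ ∞ := ENNReal.div_ne_top (by simp) hn0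
                               finiteness) (by finiteness),
      ENNReal.toReal_add (by finiteness) (ENNReal.div_ne_top (by simp) hn0)]
    have : ((n : ℝ≥0∞) + 1).toReal = n + 1 := by
      rw [ENNReal.toReal_add (by simp) (by simp)]; simp
    simp [ENNReal.toReal_mul, this]
  rw [h3] at h2
  simp only [ENNReal.toReal_mul] at h2
  have h4 := h.errorProb_le Φ
  simp only [measureReal_def] at hΦ ⊢
  linarith

lemma errorProb_eq_zero_of_size_eq_one (W : Channel d μ) {n : ℕ} (Φ : Code d 𝒴 n)
    (h : Φ.size = 1) : errorProb W Φ = 0 := by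
  have : Subsingleton (Fin Φ.size) := by rw [h]; infer_instance
  rw [errorProb_eq]
  have h0 : ∀ i, {y | Φ.dec y ≠ i} = ∅ := fun i => by
    ext y; simp [Subsingleton.elim (Φ.dec y) i]
  simp [h0]

lemma tendsto_rpow_quarter : Tendsto (fun n : ℕ => (n : ℝ) ^ (1 / 4 : ℝ)) atTop atTop :=
  (tendsto_rpow_atTop (by norm_num)).comp tendsto_natCast_atTop_atTop

/-- Either the code size is eventually `1`, or its logarithm eventually exceeds `n^{1/4}`. -/
lemma log_size_dichotomy (R₁ R₂ : ℝ) :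
    (∀ᶠ n : ℕ in atTop, n * R₁ + √n * R₂ - (n : ℝ) ^ (1 / 4 : ℝ) ≤ 0) ∨
    (∀ᶠ n : ℕ in atTop,
      (n : ℝ) ^ (1 / 4 : ℝ) ≤ n * R₁ + √n * R₂ - (n : ℝ) ^ (1 / 4 : ℝ)) := by
  have hsq : ∀ n : ℕ, √(n : ℝ) = ((n : ℝ) ^ (1 / 4 : ℝ)) ^ 2 := fun n => by
    rw [Real.sqrt_eq_rpow, ← Real.rpow_natCast, ← Real.rpow_mul (by positivity)]; norm_num
  have hn4 : ∀ n : ℕ, (n : ℝ) = ((n : ℝ) ^ (1 / 4 : ℝ)) ^ 4 := fun n => by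
    rw [← Real.rpow_natCast, ← Real.rpow_mul (by positivity)]; norm_num
  -- a polynomial in `u = n^{1/4}`
  suffices h : (∀ᶠ u : ℝ in atTop, u ^ 4 * R₁ + u ^ 2 * R₂ - u ≤ 0) ∨
      (∀ᶠ u : ℝ in atTop, u ≤ u ^ 4 * R₁ + u ^ 2 * R₂ - u) by
    refine h.imp (fun h => ?_) (fun h => ?_) <;>
    · filter_upwards [tendsto_rpow_quarter.eventually h] with n hn
      rw [hsq, show (n : ℝ) * R₁ = ((n : ℝ) ^ (1 / 4 : ℝ)) ^ 4 * R₁ by rw [← hn4]]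
      exact hn
  have hbig : ∀ c : ℝ, ∀ᶠ u : ℝ in atTop, c ≤ u := eventually_ge_atTop
  rcases lt_trichotomy R₁ 0 with h1 | h1 | h1
  · left
    filter_upwards [hbig 1, hbig (|R₂| / -R₁)] with u hu1 hu2
    rw [div_le_iff₀ (by linarith)] at hu2
    have h3 : |R₂| ≤ u ^ 2 * -R₁ :=
      hu2.trans (mul_le_mul_of_nonneg_right (by nlinarith) (by linarith))
    have h4 : u ^ 2 * R₂ ≤ u ^ 2 * (u ^ 2 * -R₁) := by
      gcongr; exact (le_abs_self _).trans h3
    nlinarith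
  · subst h1
    rcases le_or_gt R₂ 0 with h2 | h2
    · left
      filter_upwards [hbig 0] with u hu
      nlinarith [mul_nonneg (sq_nonneg u) (neg_nonneg.2 h2)]
    · right
      filter_upwards [hbig 0, hbig (2 / R₂)] with u hu hu2
      rw [div_le_iff₀ h2] at hu2
      nlinarith
  · right
    filter_upwards [hbig 1, hbig ((|R₂| + 2) / R₁)] with u hu1 hu2
    rw [div_le_iff₀ h1] at hu2
    have h3 : |R₂| + 2 ≤ u ^ 2 * R₁ :=
      hu2.trans (mul_le_mul_of_nonneg_right (by nlinarith) h1.le)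
    have h4 : u ^ 2 * (-R₂ + 2) ≤ u ^ 2 * (u ^ 2 * R₁) := by
      gcongr; linarith [neg_le_abs R₂]
    nlinarith

/-- The slack `n^{1/4}` in the code size dominates the logarithm of a polynomial. -/
lemma eventually_log_card_le (K : ℕ) {b : ℕ → ℕ} (hb : ∀ n, b n ≤ (2 * n ^ 4 + 1) ^ K) :
    ∀ᶠ n : ℕ in atTop,
      2 * Real.log ((b n + 1) * (n + 1)) + 1 + Real.log 2 ≤ (n : ℝ) ^ (1 / 4 : ℝ) := by
  have ho : (fun n : ℕ => Real.log n) =o[atTop] fun n : ℕ => (n : ℝ) ^ (1 / 4 : ℝ) :=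
    (isLittleO_log_rpow_atTop (by norm_num)).comp_tendsto tendsto_natCast_atTop_atTop
  set D : ℝ := 2 * (6 * K + 3) with hD
  have hD0 : 0 < D := by positivity
  have h1 := ho.bound (c := 1 / (2 * D)) (by positivity)
  filter_upwards [h1, eventually_ge_atTop 2,
    tendsto_rpow_quarter.eventually_ge_atTop (2 * (1 + Real.log 2))] with n hn hn2 hq
  have hnr : (2 : ℝ) ≤ n := by exact_mod_cast hn2
  have hlog0 : 0 ≤ Real.log n := Real.log_nonneg (by linarith)
  rw [Real.norm_of_nonneg hlog0, Real.norm_of_nonneg (by positivity)] at hn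
  have hle : ((b n : ℝ) + 1) * (n + 1) ≤ (n : ℝ) ^ (6 * K + 3) := by
    have e1 : 2 * n ^ 4 + 1 ≤ n ^ 6 := by
      have h16 : 2 ^ 4 ≤ n ^ 4 := Nat.pow_le_pow_left hn2 4
      calc 2 * n ^ 4 + 1 ≤ 2 * n ^ 4 + n ^ 4 := by omega
        _ = 3 * n ^ 4 := by ring
        _ ≤ n ^ 2 * n ^ 4 := by gcongr; nlinarith
        _ = n ^ 6 := by ring
    have e2 : b n + 1 ≤ n ^ (6 * K + 1) := by
      have h1' : 1 ≤ n ^ (6 * K) := Nat.one_le_pow _ _ (by omega)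
      calc b n + 1 ≤ (n ^ 6) ^ K + 1 := by gcongr; exact (hb n).trans (Nat.pow_le_pow_left e1 K)
        _ = n ^ (6 * K) + 1 := by rw [← pow_mul]
        _ ≤ n ^ (6 * K) * 2 := by omega
        _ ≤ n ^ (6 * K) * n := by gcongr
        _ = n ^ (6 * K + 1) := (pow_succ _ _).symm
    have e3 : n + 1 ≤ n ^ 2 := by nlinarith
    have : (b n + 1) * (n + 1) ≤ n ^ (6 * K + 3) := by
      calc (b n + 1) * (n + 1) ≤ n ^ (6 * K + 1) * n ^ 2 := Nat.mul_le_mul e2 e3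
        _ = _ := by rw [← pow_add]
    exact_mod_cast this
  have hlog : Real.log (((b n : ℝ) + 1) * (n + 1)) ≤ (6 * K + 3) * Real.log n := by
    refine (Real.log_le_log (by positivity) hle).trans (le_of_eq ?_)
    rw [Real.log_pow]; push_cast; ring
  have h2 : D * Real.log n ≤ (n : ℝ) ^ (1 / 4 : ℝ) / 2 := by
    calc D * Real.log n ≤ D * (1 / (2 * D) * (n : ℝ) ^ (1 / 4 : ℝ)) := by gcongr
      _ = _ := by field_simp
  nlinarith

/-- The number of messages `⌈exp (n R₁ + √n R₂ - n^{1/4})⌉`. -/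
def codeSize (R₁ R₂ : ℝ) (n : ℕ) : ℕ :=
  ⌈Real.exp (n * R₁ + √n * R₂ - (n : ℝ) ^ (1 / 4 : ℝ))⌉₊

lemma codeSize_pos (R₁ R₂ : ℝ) (n : ℕ) : 0 < codeSize R₁ R₂ n := Nat.ceil_pos.2 (Real.exp_pos _)

/-- With the threshold `T = M (b + 1) (n + 1)`, the rejection threshold for the information density
stays below `L + q`, and the random coding error for `b` channels is at most `2 / (n + 1)`. -/
lemma code_parameters_bound {M b n : ℕ} {L q : ℝ} (hM : M = ⌈Real.exp L⌉₊) (hL : q ≤ L)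
    (hq : 0 ≤ q)
    (hb : 2 * Real.log ((b + 1) * (n + 1)) + 1 + Real.log 2 ≤ q) (hn : 0 < n) (hb0 : 0 < b) :
    Real.log ((M * (b + 1) * (n + 1) : ℝ≥0) : ℝ) + Real.log (b * n) + 1 ≤ L + q ∧
    (b : ℝ) * (1 / M + M * (1 / ((M * (b + 1) * (n + 1) : ℝ≥0) : ℝ))) ≤ 2 / (n + 1) := by
  have hexp : Real.exp L ≤ M := hM ▸ Nat.le_ceil _
  have hM0 : (0 : ℝ) < M := (Real.exp_pos L).trans_le hexp
  have hM2 : (M : ℝ) ≤ 2 * Real.exp L := by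
    have h1 : (M : ℝ) ≤ Real.exp L + 1 := by
      rw [hM]; exact (Nat.ceil_lt_add_one (Real.exp_pos _).le).le
    have h2 : 1 ≤ Real.exp L := Real.one_le_exp (hq.trans hL)
    linarith
  have hbr : (0 : ℝ) < b := by exact_mod_cast hb0
  have hnr : (0 : ℝ) < n := by exact_mod_cast hn
  set B : ℝ := ((b : ℝ) + 1) * (n + 1) with hB
  have hB1 : 0 < B := by positivity
  have hcoe : ((M * (b + 1) * (n + 1) : ℝ≥0) : ℝ) = M * B := by push_cast; ring
  rw [hcoe]
  constructor
  · have h1 : Real.log (M * B) = Real.log M + Real.log B := Real.log_mul hM0.ne' hB1.ne'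
    have h2 : Real.log M ≤ Real.log 2 + L := by
      have := Real.log_le_log hM0 hM2
      rwa [Real.log_mul (by norm_num) (Real.exp_pos _).ne', Real.log_exp] at this
    have h3 : Real.log (b * n) ≤ Real.log B := by
      refine Real.log_le_log (by positivity) ?_
      rw [hB]; gcongr <;> linarith
    linarith
  · have hBL : B ≤ Real.exp L := by
      rw [← Real.log_le_iff_le_exp hB1]
      have : 0 ≤ Real.log B := Real.log_nonneg (by rw [hB]; nlinarith)
      have := Real.log_nonneg (by norm_num : (1 : ℝ) ≤ 2)
      linarith
    have h1 : (b : ℝ) * (1 / M) ≤ 1 / (n + 1) := by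
      rw [mul_one_div, div_le_div_iff₀ hM0 (by positivity)]
      have := hBL.trans hexp
      rw [hB] at this
      nlinarith
    have h2 : (b : ℝ) * (M * (1 / (M * B))) ≤ 1 / (n + 1) := by
      have : (b : ℝ) * (M * (1 / (M * B))) = b / B := by field_simp
      rw [this, div_le_div_iff₀ hB1 (by positivity), hB]
      nlinarith
    calc _ = (b : ℝ) * (1 / M) + b * (M * (1 / (M * B))) := by ring
      _ ≤ 1 / (n + 1) + 1 / (n + 1) := add_le_add h1 h2
      _ = 2 / (n + 1) := by ring

lemma tendsto_remainder (C : ℝ≥0) :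
    Tendsto (fun n : ℕ => ((n : ℝ) * ((n + 1) * (C / (n : ℝ≥0) ^ 3 : ℝ≥0)) + 1 / n +
      2 * (n * (C / (n : ℝ≥0) ^ 3 : ℝ≥0))) + (√(2 / (n + 1)) + 2 / (n + 1))) atTop (𝓝 0) := by
  have hinv : Tendsto (fun n : ℕ => 1 / (n : ℝ)) atTop (𝓝 0) := tendsto_one_div_atTop_nhds_zero_nat
  have hinv' : Tendsto (fun n : ℕ => 2 / ((n : ℝ) + 1)) atTop (𝓝 0) := by
    have := (tendsto_one_div_add_atTop_nhds_zero_nat (𝕜 := ℝ)).const_mul 2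
    simpa [div_eq_mul_inv] using this
  have hsq : Tendsto (fun n : ℕ => √(2 / ((n : ℝ) + 1))) atTop (𝓝 0) := by
    rw [← Real.sqrt_zero]
    exact (Real.continuous_sqrt.tendsto 0).comp hinv'
  have hmain : Tendsto (fun n : ℕ => (C : ℝ) * (1 / n) + (C : ℝ) * (1 / n) ^ 2 + 1 / n +
      2 * (C * (1 / (n : ℝ)) ^ 2) + (√(2 / (n + 1)) + 2 / (n + 1))) atTop (𝓝 0) := by
    have := ((((hinv.const_mul (C : ℝ)).add ((hinv.pow 2).const_mul (C : ℝ))).add hinv).add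
      (((hinv.pow 2).const_mul (C : ℝ)).const_mul 2)).add (hsq.add hinv')
    simpa using this
  refine hmain.congr' ?_
  filter_upwards [eventually_gt_atTop 0] with n hn
  have hn' : (n : ℝ) ≠ 0 := by exact_mod_cast hn.ne'
  push_cast
  field_simp

lemma tendsto_measure_sum_infoDensity_le {W : Channel d μ} {P : PMF (Fin d)}
    (hI : mutualInfo P W < ∞) (hV : 0 < infoVariance P W ∧ infoVariance P W < ∞) (c : ℝ) :
    Tendsto (fun n : ℕ => (Measure.pi fun _ : Fin n => W.joint P).real
        {z | ∑ t, W.infoDensity P (z t) ≤ n * (mutualInfo P W).toReal + √n * c}) atTop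
      (𝓝 ((ProbabilityTheory.gaussianReal 0 1).real
        (Set.Iic (c / √(infoVariance P W).toReal)))) := by
  have h := tendsto_pi_sum_le (W.joint P) _ (W.measurable_infoDensity P)
    (Channel.memLp_infoDensity hV.2)
    (by rw [Channel.variance_infoDensity hI hV.2]; exact ENNReal.toReal_pos hV.1.ne' hV.2.ne) c
  rwa [Channel.variance_infoDensity hI hV.2, Channel.integral_infoDensity hI hV.2] at h

lemma tendsto_measure_sum_infoDensity_le_zero {W : Channel d μ} {P : PMF (Fin d)}
    (hI : mutualInfo P W < ∞) (hV : 0 < infoVariance P W ∧ infoVariance P W < ∞) {R₁ : ℝ}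
    (R₂ : ℝ) (hR : R₁ < (mutualInfo P W).toReal) :
    Tendsto (fun n : ℕ => (Measure.pi fun _ : Fin n => W.joint P).real
        {z | ∑ t, W.infoDensity P (z t) ≤ n * R₁ + √n * R₂}) atTop (𝓝 0) := by
  have hv : 0 < √(infoVariance P W).toReal :=
    Real.sqrt_pos.2 (ENNReal.toReal_pos hV.1.ne' hV.2.ne)
  rw [tendsto_order]
  refine ⟨fun a ha => Eventually.of_forall fun n => ha.trans_le measureReal_nonneg,
    fun ε hε => ?_⟩
  have hcdf := ProbabilityTheory.tendsto_cdf_atBot (ProbabilityTheory.gaussianReal 0 1)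
  -- a bound at the second-order level `c'`, with `c` so small that the Gaussian tail is below `ε`
  obtain ⟨c, hc⟩ := (hcdf.eventually_lt_const hε).exists
  have h1 := tendsto_measure_sum_infoDensity_le hI hV (c * √(infoVariance P W).toReal)
  rw [mul_div_cancel_right₀ _ hv.ne', ← ProbabilityTheory.cdf_eq_real] at h1
  have hsq : Tendsto (fun n : ℕ => √(n : ℝ)) atTop atTop :=
    Real.tendsto_sqrt_atTop.comp tendsto_natCast_atTop_atTop
  set I := (mutualInfo P W).toReal
  set c' := c * √(infoVariance P W).toReal
  filter_upwards [h1.eventually_lt_const hc, hsq.eventually_ge_atTop ((R₂ - c') / (I - R₁))]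
    with n hn hn2
  refine lt_of_le_of_lt (measureReal_mono fun z hz => ?_) hn
  rw [div_le_iff₀ (by linarith)] at hn2
  have h3 : √(n : ℝ) * (R₂ - c') ≤ √(n : ℝ) * (√(n : ℝ) * (I - R₁)) := by gcongr
  have h4 : √(n : ℝ) * √(n : ℝ) = n := Real.mul_self_sqrt (by positivity)
  have hz' : ∑ t, W.infoDensity P (z t) ≤ n * R₁ + √n * R₂ := hz
  show ∑ t, W.infoDensity P (z t) ≤ n * I + √n * c'
  rw [← mul_assoc, h4] at h3
  linarith

/-- Universal codes whose error probability is asymptotically at most the probability that the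
information density sum is below `n R₁ + √n R₂`. -/
theorem exists_universal_codes {Θ : Set (Param k)} {W : Param k → Channel d μ}
    (hW : LocallyHellinger Θ W) (P : PMF (Fin d)) (R₁ R₂ : ℝ) :
    ∃ Φ : (n : ℕ) → Code d 𝒴 n, (∀ n, (Φ n).size = codeSize R₁ R₂ n) ∧
      ∀ θ ∈ Θ, ∃ ρ : ℕ → ℝ, Tendsto ρ atTop (𝓝 0) ∧ ∀ᶠ n : ℕ in atTop,
        errorProb (W θ) (Φ n) ≤ (Measure.pi fun _ : Fin n => (W θ).joint P).real
          {z | ∑ t, (W θ).infoDensity P (z t) ≤ n * R₁ + √n * R₂} + ρ n := by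
  obtain ⟨K, N, hcard, hN⟩ := hW.exists_nets
  let T : ℕ → ℝ≥0 := fun n => codeSize R₁ R₂ n * ((N n).card + 1) * (n + 1)
  have hT : ∀ n, 0 < T n := fun n => by
    have : 0 < codeSize R₁ R₂ n := codeSize_pos R₁ R₂ n
    positivity
  choose Φ hsize hΦ using fun n =>
    exists_code_of_finset (n := n) (N n) W P (codeSize_pos R₁ R₂ n) (hT n)
  refine ⟨Φ, hsize, fun θ hθ => ?_⟩
  rcases log_size_dichotomy R₁ R₂ with hL | hL
  · refine ⟨fun _ => 0, tendsto_const_nhds, ?_⟩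
    filter_upwards [hL] with n hn
    have hone : codeSize R₁ R₂ n = 1 := by
      refine le_antisymm ?_ (codeSize_pos R₁ R₂ n)
      rw [codeSize, Nat.ceil_le]
      simpa using hn
    rw [errorProb_eq_zero_of_size_eq_one _ _ ((hsize n).trans hone), add_zero]
    exact measureReal_nonneg
  · obtain ⟨C, hC⟩ := hN θ hθ
    refine ⟨_, tendsto_remainder C, ?_⟩
    filter_upwards [hL, hC, eventually_log_card_le K hcard, eventually_gt_atTop 0]
      with n hLn ⟨θ', hθ', hclose⟩ hlog hn
    have hb0 : 0 < (N n).card := Finset.card_pos.2 ⟨θ', hθ'⟩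
    obtain ⟨h1, h2⟩ := code_parameters_bound (M := codeSize R₁ R₂ n) rfl hLn (by positivity)
      hlog hn hb0
    have h3 := hΦ n θ' hθ'
    rw [add_assoc] at h3
    have h4 := errorProb_le_of_isClose hθ' hclose hn (hT n) h3
    have h5 : ((N n).card : ℝ) * (1 / codeSize R₁ R₂ n + codeSize R₁ R₂ n * (1 / (T n : ℝ))) ≤
        2 / (n + 1) := h2
    have h6 : (Measure.pi fun _ : Fin n => (W θ).joint P).real {z | ∑ t, (W θ).infoDensity P (z t) ≤
          Real.log (T n) + Real.log ((N n).card * n) + 1} ≤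
        (Measure.pi fun _ : Fin n => (W θ).joint P).real
          {z | ∑ t, (W θ).infoDensity P (z t) ≤ n * R₁ + √n * R₂} := by
      refine measureReal_mono fun z hz => ?_
      have hz' : ∑ t, (W θ).infoDensity P (z t) ≤
        Real.log (T n) + Real.log ((N n).card * n) + 1 := hz
      have h7 : Real.log (T n) + Real.log ((N n).card * n) + 1 ≤ _ := h1
      show ∑ t, (W θ).infoDensity P (z t) ≤ n * R₁ + √n * R₂
      linarith
    have h8 := Real.sqrt_le_sqrt h5
    linarith

end UniversalCoding

end

theorem theorem2 {d : ℕ} {𝒴 : Type*} [MeasurableSpace 𝒴] (μ : Measure 𝒴)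
    (k : Fin d → ℕ) (Θ : Set (Param k)) (W : Param k → Channel d μ)
    (P : PMF (Fin d)) (R₁ R₂ : ℝ)
    (hW : ConditionA Θ W ∨ ConditionB Θ W ∨ ConditionC Θ W)
    (hI : ∀ θ ∈ Θ, 0 < mutualInfo P (W θ) ∧ mutualInfo P (W θ) < ∞)
    (hV : ∀ θ ∈ Θ, 0 < infoVariance P (W θ) ∧ infoVariance P (W θ) < ∞) :
    ∃ Φ : (n : ℕ) → Code d 𝒴 n,
      (∀ n : ℕ, (Φ n).size =
        ⌈Real.exp (n * R₁ + Real.sqrt n * R₂ - (n : ℝ) ^ (1 / 4 : ℝ))⌉₊) ∧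
      ∀ θ ∈ Θ,
        (R₁ < (mutualInfo P (W θ)).toReal →
          Tendsto (fun n => errorProb (W θ) (Φ n)) atTop (𝓝 0)) ∧
        ((mutualInfo P (W θ)).toReal = R₁ →
          limsup (fun n => errorProb (W θ) (Φ n)) atTop ≤
            ∫ x in Set.Iic (R₂ / Real.sqrt (infoVariance P (W θ)).toReal),
              1 / Real.sqrt (2 * Real.pi) * Real.exp (-(x ^ 2) / 2)) := by
  obtain ⟨Φ, hsize, hΦ⟩ := exists_universal_codes (locallyHellinger_of_condition hW) P R₁ R₂
  refine ⟨Φ, hsize, fun θ hθ => ?_⟩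
  obtain ⟨ρ, hρ, hle⟩ := hΦ θ hθ
  constructor
  · intro hR
    have h1 := (tendsto_measure_sum_infoDensity_le_zero (hI θ hθ).2 (hV θ hθ) R₂ hR).add hρ
    rw [add_zero] at h1
    exact tendsto_of_tendsto_of_tendsto_of_le_of_le' tendsto_const_nhds h1
      (Eventually.of_forall fun n => errorProb_nonneg _ _) hle
  · intro hR
    have h1 := (tendsto_measure_sum_infoDensity_le (hI θ hθ).2 (hV θ hθ) R₂).add hρ
    rw [hR, add_zero, measureReal_gaussianReal_Iic] at h1
    rw [← h1.limsup_eq]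
    exact limsup_le_limsup hle
      (isBoundedUnder_of ⟨0, fun n => errorProb_nonneg _ _⟩).isCoboundedUnder_le
      h1.isBoundedUnder_le
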